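/- **Setting.** There are $N$ agents and a resource of capacity $\gamma\in\{1,\dots,N-1\}$; let $0<\Delta\le 1$. In each period $t=1,2,\dots$ agent $i$ has a valuation $v_{i,t}\in[0,1]$; valuations are independent across agents and periods, and $v_{i,t}$ has a density $\nu_i:[0,1]\to[\underline\nu,\overline\nu]$ with $0<\underline\nu$. Given bids $b_{1},\dots,b_{N}$, the competing bid $d_{i}^\gamma$ of agent $i$ is the $\gamma$-th largest of $(b_{j})_{j\ne i}$, and $x_i=\mathbf 1\{b_i>d_i^\gamma\}$; agent $i$ pays $z_i=x_i d_i^\gamma$ and incurs the cost $v_i(1-\Delta x_i)$. There are no budget gains. Fix bounds $0<\underline\mu<\overline\mu$ and target rates $\rho_i>0$. For horizon $T\ge1$, step size $\epsilon>0$ and initial multipliers $\mu_{i,1}\in[\underline\mu,\overline\mu]$, adaptive pacing (strategy $A$) starts with the budget $k_{i,1}=\rho_iT$ and uses $$b_{i,t}=\min\{\Delta v_{i,t}/\mu_{i,t},\,k_{i,t}\},\quad \mu_{i,t+1}=P_{[\underline\mu,\overline\mu]}\big(\mu_{i,t}+\epsilon(z_{i,t}-\rho_i)\big),\quad k_{i,t+1}=k_{i,t}-z_{i,t}.$$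 Let $\mathcal C_i^{A}$ be the expected total cost of agent $i$ over $T$ periods when all agents use $A$. For $\mu\in\mathbb R_{>0}^N$ let, with $d_i^\gamma$ computed from the bids $\Delta v_j/\mu_j$, $$\Psi_i(\mu)=\mathbb E_v\big[v_i-\mu_i\rho_i-(\Delta v_i-\mu_i d_i^\gamma)^+\big],\qquad Z_i(\mu)=\mathbb E_v\big[d_i^\gamma\,\mathbf 1\{\Delta v_i>\mu_i d_i^\gamma\}\big].$$ **Theorem.** Suppose that for some $\lambda>0$ the expected expenditure satisfies $(\mu-\mu')^\top(Z(\mu)-Z(\mu'))\le-\lambda\|\mu-\mu'\|_2^2$ for all $\mu,\mu'\in U=(\underline\mu,\overline\mu)^N$, and let $\mu^\star\in U$ be a stationary profile, i.e. $Z_i(\mu^\star)=\rho_i$ for all $i$. Then there are constants $C_1,C_2\ge0$, independent of $T$, of $\epsilon$ and of the initial multipliers, such that for all $T\ge 1$, all $\epsilon>0$, all initial multipliers in $[\underline\mu,\overline\mu]^N$ and all agents $i$ $$\frac1T\sum_{t=1}^T\mathbb E\big[\|\mu_t-\mu^\star\|_2^2\big]\le C_1N\Big(\epsilon+\frac{1+\epsilon}{\epsilon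 T}\Big),\qquad \Big|\frac1T\mathcal C_i^{A}-\Psi_i(\mu^\star)\Big|\le C_2\Big(\frac1T+N\Big(\epsilon^{1/2}+\frac1{\epsilon T}\Big)\Big).$$ If moreover $\overline\mu\ge\Delta/\rho_i$ for all $i$, then $C_1$ and $C_2$ can be chosen to depend only on $\Delta,\underline\mu,\overline\mu,\overline\nu,\lambda$ (in particular not on $N$). Finally, if the step size $\epsilon(T)>0$ satisfies $\epsilon(T)\to0$ and $T\epsilon(T)\to\infty$ as $T\to\infty$, then for any initial multipliers in $[\underline\mu,\overline\mu]^N$ (possibly depending on $T$) and every agent $i$ $$\lim_{T\to\infty}\frac1T\sum_{t=1}^T\mathbb E\big[\|\mu_t-\mu^\star\|_2^2\big]=0,\qquad \lim_{T\to\infty}\Big(\frac1T\mathcal C_i^{A}-\Psi_i(\mu^\star)\Big)=0.$$ -/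

import Mathlib

open MeasureTheory

noncomputable section

/-- The `k`-th largest value of the family `b` over the index set `s` (values counted with
multiplicity): the largest real `x` such that at least `k` of the values are `≥ x`. -/
def kthLargest {ι : Type*} (s : Finset ι) (k : ℕ) (b : ι → ℝ) : ℝ :=
  sSup {x : ℝ | k ≤ (s.filter (fun j => x ≤ b j)).card}

/-- For `1 ≤ k ≤ |s|` the supremum in `kthLargest` is a maximum. -/
theorem isGreatest_kthLargest {ι : Type*} (s : Finset ι) (k : ℕ) (b : ι → ℝ)
    (hk : 1 ≤ k) (hks : k ≤ s.card) :
    IsGreatest {x : ℝ | k ≤ (s.filter (fun j => x ≤ b j)).card} (kthLargest s k b) := by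
  classical
  let V : Finset ℝ := (s.image b).filter (fun x => k ≤ (s.filter (fun j => x ≤ b j)).card)
  have hmem : ∀ x, k ≤ (s.filter (fun j => x ≤ b j)).card → ∃ y ∈ V, x ≤ y := by
    intro x hx
    have hne : ((s.filter (fun j => x ≤ b j)).image b).Nonempty := by
      rw [Finset.image_nonempty, ← Finset.card_pos]; omega
    obtain ⟨j, hj, hjy⟩ := Finset.mem_image.1 (Finset.min'_mem _ hne)
    rw [Finset.mem_filter] at hj
    refine ⟨b j, ?_, hj.2⟩
    refine Finset.mem_filter.2 ⟨Finset.mem_image_of_mem b hj.1, hx.trans (Finset.card_le_card ?_)⟩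
    intro l hl
    refine Finset.mem_filter.2 ⟨(Finset.mem_filter.1 hl).1, ?_⟩
    rw [hjy]
    exact Finset.min'_le _ _ (Finset.mem_image_of_mem b hl)
  have hVne : V.Nonempty := by
    have hs : (s.image b).Nonempty := by
      rw [Finset.image_nonempty, ← Finset.card_pos]; omega
    obtain ⟨y, hy, -⟩ := hmem ((s.image b).min' hs) (by
      rw [Finset.filter_true_of_mem]
      · exact hks
      · intro j hj
        exact Finset.min'_le _ _ (Finset.mem_image_of_mem b hj))
    exact ⟨y, hy⟩
  have hg : IsGreatest {x : ℝ | k ≤ (s.filter (fun j => x ≤ b j)).card} (V.max' hVne) := by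
    refine ⟨(Finset.mem_filter.1 (Finset.max'_mem V hVne)).2, ?_⟩
    intro x hx
    obtain ⟨y, hy, hxy⟩ := hmem x hx
    exact hxy.trans (Finset.le_max' V y hy)
  have hEq : kthLargest s k b = V.max' hVne := hg.csSup_eq
  rw [hEq]
  exact hg

/-- The repeated allocation game without budget gains, with `N` agents: capacity `γ ∈ [N-1]` of
the priority road, time saving `Δ` (`0 ≤ 1 - Δ < 1`), densities `ν i` on `[0,1]` of the
valuations, with values in `[νlo, νhi] ⊂ (0, ∞)`; together with the parameters of adaptive pacing
that do not vary: target expenditure rates `ρ i` and multiplier bounds `μlo < μhi`. -/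
structure PacingGame (N : ℕ) where
  γ : ℕ
  one_le_γ : 1 ≤ γ
  γ_lt : γ < N
  Δ : ℝ
  Δ_pos : 0 < Δ
  Δ_le_one : Δ ≤ 1
  ν : Fin N → ℝ → ℝ
  νlo : ℝ
  νhi : ℝ
  νlo_pos : 0 < νlo
  ν_measurable : ∀ i, Measurable (ν i)
  ν_mem : ∀ i, ∀ x ∈ Set.Icc (0 : ℝ) 1, ν i x ∈ Set.Icc νlo νhi
  ν_integral : ∀ i, ∫ x in Set.Icc (0 : ℝ) 1, ν i x = 1
  ρ : Fin N → ℝ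
  ρ_pos : ∀ i, 0 < ρ i
  μlo : ℝ
  μhi : ℝ
  μlo_pos : 0 < μlo
  μlo_lt_μhi : μlo < μhi

/-- Multipliers and karma budgets of all agents at the beginning of a period. -/
structure PacingState (N : ℕ) where
  mult : Fin N → ℝ
  budget : Fin N → ℝ

namespace PacingGame

variable {N : ℕ} (G : PacingGame N)

/-- The valuation distribution of agent `i`, with density `ν i` on `[0,1]`. -/
def valuation (i : Fin N) : Measure ℝ :=
  (volume.restrict (Set.Icc (0 : ℝ) 1)).withDensity (fun x => ENNReal.ofReal (G.ν i x))

instance isProbabilityMeasure_valuation (i : Fin N) : IsProbabilityMeasure (G.valuation i) := by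
  constructor
  have hint : Integrable (G.ν i) (volume.restrict (Set.Icc (0 : ℝ) 1)) :=
    integrable_of_integral_eq_one (G.ν_integral i)
  have hnn : 0 ≤ᵐ[volume.restrict (Set.Icc (0 : ℝ) 1)] G.ν i :=
    (ae_restrict_mem measurableSet_Icc).mono
      (fun x hx => G.νlo_pos.le.trans (G.ν_mem i x hx).1)
  rw [valuation, withDensity_apply _ MeasurableSet.univ, Measure.restrict_univ,
    ← ofReal_integral_eq_lintegral_ofReal hint hnn, G.ν_integral i, ENNReal.ofReal_one]

/-- The law of the valuation profile of one period: independent across agents. -/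
def profileLaw : Measure (Fin N → ℝ) := Measure.pi G.valuation

instance isProbabilityMeasure_profileLaw : IsProbabilityMeasure G.profileLaw := by
  unfold profileLaw; infer_instance

/-- The law of the sequence of valuation profiles: independent across periods. -/
def pathLaw : Measure (ℕ → Fin N → ℝ) := Measure.infinitePi (fun _ : ℕ => G.profileLaw)

instance isProbabilityMeasure_pathLaw : IsProbabilityMeasure G.pathLaw := by
  unfold pathLaw; infer_instance

/-- The competing bid of agent `i`: the `γ`-th largest bid among the other agents. -/
def competingBid (b : Fin N → ℝ) (i : Fin N) : ℝ :=
  kthLargest (Finset.univ.erase i) G.γ b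

open Classical in
/-- The indicator that agent `i` is an auction winner under the bid profile `b`. -/
def win (b : Fin N → ℝ) (i : Fin N) : ℝ :=
  if G.competingBid b i < b i then 1 else 0

/-- The payment of agent `i` under the bid profile `b`. -/
def payment (b : Fin N → ℝ) (i : Fin N) : ℝ :=
  G.win b i * G.competingBid b i

/-- The cost of agent `i` with valuation profile `v` under the bid profile `b`. -/
def cost (v b : Fin N → ℝ) (i : Fin N) : ℝ :=
  v i * (1 - G.win b i * G.Δ)

/-- The bid profile `Δ v_j / μ_j` without budget constraint. -/
def idealBid (μ v : Fin N → ℝ) (j : Fin N) : ℝ :=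
  G.Δ * v j / μ j

/-- The expected dual objective `Ψ_i(μ)`. -/
def dualObjective (i : Fin N) (μ : Fin N → ℝ) : ℝ :=
  ∫ v, (v i - μ i * G.ρ i
    - max (G.Δ * v i - μ i * G.competingBid (G.idealBid μ v) i) 0) ∂G.profileLaw

open Classical in
/-- The expected expenditure `Z_i(μ)`. -/
def expenditure (i : Fin N) (μ : Fin N → ℝ) : ℝ :=
  ∫ v, G.competingBid (G.idealBid μ v) i *
    (if G.Δ * v i > μ i * G.competingBid (G.idealBid μ v) i then 1 else 0) ∂G.profileLaw

/-- The open box `U = ∏ (μlo, μhi)`. -/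
def openBox : Set (Fin N → ℝ) := {μ | ∀ i, μ i ∈ Set.Ioo G.μlo G.μhi}

/-- The closed box in which the multipliers evolve. -/
def closedBox : Set (Fin N → ℝ) := {μ | ∀ i, μ i ∈ Set.Icc G.μlo G.μhi}

/-- `λ`-strong monotonicity of the expected expenditure over the open box. -/
def StronglyMonotone (lam : ℝ) : Prop :=
  ∀ μ ∈ G.openBox, ∀ μ' ∈ G.openBox,
    ∑ i, (μ i - μ' i) * (G.expenditure i μ - G.expenditure i μ')
      ≤ -lam * ∑ i, (μ i - μ' i) ^ 2

/-- A stationary multiplier profile. -/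
def IsStationary (μ : Fin N → ℝ) : Prop :=
  (∀ i, 0 < μ i) ∧ ∀ i, G.expenditure i μ = G.ρ i

/-- The projection onto `[μlo, μhi]`. -/
def proj (x : ℝ) : ℝ := min (max x G.μlo) G.μhi

/-- The bids of adaptive pacing in state `s` when the valuation profile is `v`. -/
def pacingBid (s : PacingState N) (v : Fin N → ℝ) (j : Fin N) : ℝ :=
  min (G.Δ * v j / s.mult j) (s.budget j)

/-- One period in which all agents use adaptive pacing with step size `ε`. -/
def step (ε : ℝ) (s : PacingState N) (v : Fin N → ℝ) : PacingState N where
  mult i := G.proj (s.mult i + ε * (G.payment (G.pacingBid s v) i - G.ρ i))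
  budget i := s.budget i - G.payment (G.pacingBid s v) i

/-- The state at the beginning of period `t + 1` (periods are counted from `1`, so `state 0` is
the initial state) along the valuation path `v`, for horizon `T`, step size `ε` and initial
multipliers `μ₁`. The initial budgets are `ρ i * T`. -/
def state (T : ℕ) (ε : ℝ) (μ₁ : Fin N → ℝ) (v : ℕ → Fin N → ℝ) : ℕ → PacingState N
  | 0 => ⟨μ₁, fun i => G.ρ i * T⟩
  | t + 1 => G.step ε (state T ε μ₁ v t) (v t)

/-- The average over the horizon of the expected squared distance of the multiplier profile
to `μ'`. -/
def avgSqDist (T : ℕ) (ε : ℝ) (μ₁ μ' : Fin N → ℝ) : ℝ :=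
  (1 / (T : ℝ)) * ∑ t ∈ Finset.range T,
    ∫ v, (∑ i, ((G.state T ε μ₁ v t).mult i - μ' i) ^ 2) ∂G.pathLaw

/-- The strategic competition cost of agent `i` when all agents use adaptive pacing: the expected
total cost over the horizon. -/
def strategicCost (T : ℕ) (ε : ℝ) (μ₁ : Fin N → ℝ) (i : Fin N) : ℝ :=
  ∫ v, (∑ t ∈ Finset.range T,
    G.cost (v t) (G.pacingBid (G.state T ε μ₁ v t) (v t)) i) ∂G.pathLaw

end PacingGame

end

/-! While every budget is at least `maxBid` = Δ/μlo, no bid is truncated, and the multiplier update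
is a projected stochastic step with mean direction Z(μ) − ρ = Z(μ) − Z(μ⋆). The projection is
nonexpansive and Z is strongly monotone, so the expected squared distance D_t on the event of ample
budgets obeys D_{t+1} ≤ (1 − 2ελ) D_t + N(ε·maxBid)² (`integral_sqDist_step_le`,
`ampleSqDist_succ_le`). Budgets only decrease, so the ample periods form an initial segment and
these events are nested; the sum of the D_t is then of order N(1/ε + Tε).

It remains to count the non-ample periods. A multiplier records spending: apart from projections,
(μ_t − μ_1)/ε is the expenditure in excess of the target rate, and multipliers are bounded, so
budgets cannot run out long before T. A projection at the lower bound only helps. One at the upper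
bound is impossible for small ε when Δ ≤ ρ_i μhi; in general it can happen only at a fixed distance
from μ⋆, so its effect is charged to the squared distances already summed. `TracksExpenditure`
covers both cases, and `TracksExpenditure.sum_not_ample_le` gives the count along each path.

For the costs, Ψ_i(μ⋆) is the expected one-period cost at μ⋆, because μ_i(Z_i − ρ_i) vanishes there.
The expected cost is Lipschitz in the multipliers: the allocation changes only near a tie, and near
ties are rare since v_i has a bounded density and is independent of the competing bid
(`profileLaw_tie_le`). Hence the error in an ample period is of order √D_t, and non-ample periods
cost at most 1 each. The recursion is solved for √D_t directly (`le_sq_of_contraction`), which gives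
the summand 1/(εT) rather than its square root. Large step sizes are covered by trivial bounds. -/

/-! ### Order statistics. -/

/-- The supremum is attained, so comparisons with the order statistic reduce to comparing
cardinalities of superlevel sets. -/
theorem le_kthLargest_iff {ι : Type*} {s : Finset ι} {k : ℕ} (hk : 1 ≤ k) (hks : k ≤ s.card)
    (b : ι → ℝ) (x : ℝ) :
    x ≤ kthLargest s k b ↔ k ≤ (s.filter (fun j => x ≤ b j)).card := by
  refine ⟨fun h => ?_, fun h => (isGreatest_kthLargest s k b hk hks).2 h⟩
  have h1 : k ≤ (s.filter (fun j => kthLargest s k b ≤ b j)).card :=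
    (isGreatest_kthLargest s k b hk hks).1
  refine h1.trans (Finset.card_le_card fun j hj => ?_)
  rw [Finset.mem_filter] at hj ⊢
  exact ⟨hj.1, h.trans hj.2⟩

/-- Raising every value by at most η enlarges each superlevel set no more than lowering its level by
η does. Applied both ways, this makes the order statistic 1-Lipschitz in the sup norm. -/
theorem kthLargest_le_add {ι : Type*} {s : Finset ι} {k : ℕ} (hk : 1 ≤ k) (hks : k ≤ s.card)
    {b b' : ι → ℝ} {η : ℝ} (h : ∀ j ∈ s, b j ≤ b' j + η) :
    kthLargest s k b ≤ kthLargest s k b' + η := by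
  rw [← sub_le_iff_le_add, le_kthLargest_iff hk hks]
  refine ((le_kthLargest_iff hk hks b _).1 le_rfl).trans (Finset.card_le_card fun j hj => ?_)
  rw [Finset.mem_filter] at hj ⊢
  exact ⟨hj.1, by linarith [h j hj.1, hj.2]⟩

theorem kthLargest_congr {ι : Type*} {s : Finset ι} {k : ℕ} {b b' : ι → ℝ}
    (h : ∀ j ∈ s, b j = b' j) : kthLargest s k b = kthLargest s k b' := by
  unfold kthLargest
  congr 1
  ext x
  rw [Set.mem_ofPred_eq, Set.mem_ofPred_eq,
    Finset.filter_congr (q := fun j => x ≤ b' j) (fun j hj => by rw [h j hj])]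

theorem kthLargest_nonneg {ι : Type*} {s : Finset ι} {k : ℕ} (hk : 1 ≤ k) (hks : k ≤ s.card)
    {b : ι → ℝ} (h : ∀ j ∈ s, 0 ≤ b j) : 0 ≤ kthLargest s k b := by
  rw [le_kthLargest_iff hk hks, Finset.filter_true_of_mem h]
  exact hks

theorem continuous_kthLargest {ι : Type*} [Fintype ι] {s : Finset ι} {k : ℕ} (hk : 1 ≤ k)
    (hks : k ≤ s.card) : Continuous (kthLargest s k) := by
  have h : LipschitzWith 1 (kthLargest s k) := by
    refine LipschitzWith.of_le_add fun b b' => kthLargest_le_add hk hks fun j _ => ?_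
    have := (abs_le.1 ((Real.dist_eq _ _).symm.le.trans (dist_le_pi_dist b b' j))).2
    linarith
  exact h.continuous

/-! ### The auction of a single period. -/

namespace PacingGame

variable {N : ℕ} (G : PacingGame N)

theorem γ_le_card_erase (i : Fin N) : G.γ ≤ (Finset.univ.erase i).card := by
  have := G.γ_lt
  rw [Finset.card_erase_of_mem (Finset.mem_univ i), Finset.card_univ, Fintype.card_fin]
  omega

theorem measurable_competingBid (i : Fin N) : Measurable (fun b => G.competingBid b i) :=
  (continuous_kthLargest G.one_le_γ (G.γ_le_card_erase i)).measurable

theorem measurable_win (i : Fin N) : Measurable (fun b => G.win b i) := by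
  unfold win
  exact Measurable.ite (measurableSet_lt (G.measurable_competingBid i) (measurable_pi_apply i))
    measurable_const measurable_const

theorem measurable_payment (i : Fin N) : Measurable (fun b => G.payment b i) :=
  (G.measurable_win i).mul (G.measurable_competingBid i)

theorem competingBid_nonneg {b : Fin N → ℝ} (hb : ∀ j, 0 ≤ b j) (i : Fin N) :
    0 ≤ G.competingBid b i :=
  kthLargest_nonneg G.one_le_γ (G.γ_le_card_erase i) fun j _ => hb j

theorem competingBid_congr {b b' : Fin N → ℝ} {i : Fin N} (h : ∀ j, j ≠ i → b j = b' j) :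
    G.competingBid b i = G.competingBid b' i :=
  kthLargest_congr fun j hj => h j (Finset.ne_of_mem_erase hj)

theorem abs_competingBid_sub_le {b b' : Fin N → ℝ} {η : ℝ} (h : ∀ j, |b j - b' j| ≤ η)
    (i : Fin N) : |G.competingBid b i - G.competingBid b' i| ≤ η := by
  have h1 := kthLargest_le_add G.one_le_γ (G.γ_le_card_erase i) (b := b) (b' := b') (η := η)
    fun j _ => by linarith [(abs_le.1 (h j)).2]
  have h2 := kthLargest_le_add G.one_le_γ (G.γ_le_card_erase i) (b := b') (b' := b) (η := η)
    fun j _ => by linarith [(abs_le.1 (h j)).1]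
  rw [abs_le]
  unfold competingBid
  constructor <;> linarith

theorem win_nonneg (b : Fin N → ℝ) (i : Fin N) : 0 ≤ G.win b i := by
  unfold win; split_ifs <;> norm_num

theorem win_le_one (b : Fin N → ℝ) (i : Fin N) : G.win b i ≤ 1 := by
  unfold win; split_ifs <;> norm_num

theorem payment_nonneg {b : Fin N → ℝ} (hb : ∀ j, 0 ≤ b j) (i : Fin N) : 0 ≤ G.payment b i :=
  mul_nonneg (G.win_nonneg b i) (G.competingBid_nonneg hb i)

theorem payment_le_bid {b : Fin N → ℝ} (hb : ∀ j, 0 ≤ b j) (i : Fin N) :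
    G.payment b i ≤ b i := by
  unfold payment win
  split_ifs with h
  · rw [one_mul]; exact h.le
  · rw [zero_mul]; exact hb i

theorem cost_mem_Icc {v : Fin N → ℝ} (b : Fin N → ℝ) {i : Fin N} (hv : v i ∈ Set.Icc (0 : ℝ) 1) :
    G.cost v b i ∈ Set.Icc (0 : ℝ) 1 := by
  have h0 := G.Δ_pos
  have h1 := G.Δ_le_one
  obtain ⟨hv0, hv1⟩ := hv
  unfold cost win
  split_ifs
  · constructor <;> nlinarith
  · simp [hv0, hv1]

theorem measurable_cost (i : Fin N) :
    Measurable (fun p : (Fin N → ℝ) × (Fin N → ℝ) => G.cost p.1 p.2 i) := by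
  unfold cost
  have h2 : Measurable fun p : (Fin N → ℝ) × (Fin N → ℝ) => G.win p.2 i :=
    (G.measurable_win i).comp measurable_snd
  have h1 : Measurable fun p : (Fin N → ℝ) × (Fin N → ℝ) => p.1 i := by fun_prop
  exact h1.mul (measurable_const.sub (h2.mul_const _))

/-- An upper bound for all bids that are not constrained by the budget. -/
noncomputable def maxBid : ℝ := G.Δ / G.μlo

theorem maxBid_pos : 0 < G.maxBid := div_pos G.Δ_pos G.μlo_pos

theorem openBox_subset_closedBox : G.openBox ⊆ G.closedBox :=
  fun _ h i => ⟨(h i).1.le, (h i).2.le⟩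

theorem pos_of_mem_closedBox {μ : Fin N → ℝ} (hμ : μ ∈ G.closedBox) (i : Fin N) : 0 < μ i :=
  G.μlo_pos.trans_le (hμ i).1

theorem idealBid_nonneg {μ v : Fin N → ℝ} (hμ : μ ∈ G.closedBox)
    (hv : ∀ j, v j ∈ Set.Icc (0 : ℝ) 1) (j : Fin N) : 0 ≤ G.idealBid μ v j :=
  div_nonneg (mul_nonneg G.Δ_pos.le (hv j).1) (G.pos_of_mem_closedBox hμ j).le

theorem idealBid_le_div {μ v : Fin N → ℝ} (hμ : μ ∈ G.closedBox)
    (hv : ∀ j, v j ∈ Set.Icc (0 : ℝ) 1) (j : Fin N) : G.idealBid μ v j ≤ G.Δ / μ j :=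
  div_le_div_of_nonneg_right (mul_le_of_le_one_right G.Δ_pos.le (hv j).2)
    (G.pos_of_mem_closedBox hμ j).le

theorem div_le_maxBid {μ : Fin N → ℝ} (hμ : μ ∈ G.closedBox) (j : Fin N) :
    G.Δ / μ j ≤ G.maxBid :=
  div_le_div_of_nonneg_left G.Δ_pos.le G.μlo_pos (hμ j).1

theorem idealBid_le_maxBid {μ v : Fin N → ℝ} (hμ : μ ∈ G.closedBox)
    (hv : ∀ j, v j ∈ Set.Icc (0 : ℝ) 1) (j : Fin N) : G.idealBid μ v j ≤ G.maxBid :=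
  (G.idealBid_le_div hμ hv j).trans (G.div_le_maxBid hμ j)

theorem abs_idealBid_sub_le {μ μ' v : Fin N → ℝ} (hμ : μ ∈ G.closedBox) (hμ' : μ' ∈ G.closedBox)
    (hv : ∀ j, v j ∈ Set.Icc (0 : ℝ) 1) (j : Fin N) :
    |G.idealBid μ v j - G.idealBid μ' v j| ≤ G.Δ / G.μlo ^ 2 * |μ j - μ' j| := by
  have hp := G.pos_of_mem_closedBox hμ j
  have hp' := G.pos_of_mem_closedBox hμ' j
  have hlo := G.μlo_pos
  have hΔ := G.Δ_pos
  have e : G.idealBid μ v j - G.idealBid μ' v j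
      = G.Δ * v j / (μ j * μ' j) * (μ' j - μ j) := by
    unfold idealBid; field_simp
  rw [e, abs_mul, abs_sub_comm (μ' j), abs_of_nonneg
    (div_nonneg (mul_nonneg hΔ.le (hv j).1) (mul_pos hp hp').le)]
  refine mul_le_mul_of_nonneg_right ?_ (abs_nonneg _)
  refine div_le_div₀ hΔ.le (mul_le_of_le_one_right hΔ.le (hv j).2) (by positivity) ?_
  rw [sq]
  exact mul_le_mul (hμ j).1 (hμ' j).1 hlo.le hp.le

theorem measurable_idealBid (μ : Fin N → ℝ) : Measurable (G.idealBid μ) := by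
  unfold idealBid
  fun_prop

theorem expenditure_eq {μ : Fin N → ℝ} (hμ : ∀ i, 0 < μ i) (i : Fin N) :
    G.expenditure i μ = ∫ v, G.payment (G.idealBid μ v) i ∂G.profileLaw := by
  unfold expenditure payment win
  congr 1
  ext v
  rw [mul_comm]
  have : (G.Δ * v i > μ i * G.competingBid (G.idealBid μ v) i)
      ↔ G.competingBid (G.idealBid μ v) i < G.idealBid μ v i := by
    rw [idealBid, lt_div_iff₀ (hμ i), mul_comm (μ i)]
  simp only [this]

theorem ae_profileLaw : ∀ᵐ w ∂G.profileLaw, ∀ i, w i ∈ Set.Icc (0 : ℝ) 1 := by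
  rw [ae_all_iff]
  intro i
  have h : ∀ᵐ x ∂G.valuation i, x ∈ Set.Icc (0 : ℝ) 1 := by
    have hac : G.valuation i ≪ volume.restrict (Set.Icc (0 : ℝ) 1) :=
      withDensity_absolutelyContinuous _ _
    exact hac (ae_restrict_mem measurableSet_Icc)
  exact (measurePreserving_eval G.valuation i).quasiMeasurePreserving.ae h

theorem ae_pathLaw : ∀ᵐ v ∂G.pathLaw, ∀ t i, v t i ∈ Set.Icc (0 : ℝ) 1 := by
  rw [ae_all_iff]
  intro t
  exact (measurePreserving_eval_infinitePi (fun _ : ℕ => G.profileLaw) t).quasiMeasurePreserving.ae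
    G.ae_profileLaw

/-! ### Near ties and Lipschitz dependence on the multipliers. -/

theorem νhi_pos : 0 < G.νhi := by
  obtain ⟨h1, h2⟩ := G.ν_mem ⟨0, by have := G.γ_lt; omega⟩ 0 (by simp)
  linarith [G.νlo_pos]

theorem valuation_le (i : Fin N) {s : Set ℝ} (hs : MeasurableSet s) :
    G.valuation i s ≤ ENNReal.ofReal G.νhi * volume s := by
  rw [valuation, withDensity_apply _ hs, Measure.restrict_restrict hs]
  calc ∫⁻ x in s ∩ Set.Icc 0 1, ENNReal.ofReal (G.ν i x)
      ≤ ∫⁻ _ in s ∩ Set.Icc 0 1, ENNReal.ofReal G.νhi := by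
        refine setLIntegral_mono' (hs.inter measurableSet_Icc) fun x hx => ?_
        exact ENNReal.ofReal_le_ofReal (G.ν_mem i x hx.2).2
    _ = ENNReal.ofReal G.νhi * volume (s ∩ Set.Icc 0 1) := setLIntegral_const _ _
    _ ≤ _ := by gcongr; exact Set.inter_subset_left

theorem measurableSet_tie (μ : Fin N → ℝ) (i : Fin N) (η : ℝ) :
    MeasurableSet {v | |G.idealBid μ v i - G.competingBid (G.idealBid μ v) i| ≤ η} := by
  have h1 := (measurable_pi_apply i).comp (G.measurable_idealBid μ)
  have h2 := (G.measurable_competingBid i).comp (G.measurable_idealBid μ)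
  exact measurableSet_le (h1.sub h2).abs measurable_const

/-- Near ties between an agent's bid and the competing bid are unlikely. -/
theorem profileLaw_tie_le {μ : Fin N → ℝ} (i : Fin N) (hμ : 0 < μ i) {η : ℝ} :
    G.profileLaw {v | |G.idealBid μ v i - G.competingBid (G.idealBid μ v) i| ≤ η}
      ≤ ENNReal.ofReal (G.νhi * (2 * η * μ i / G.Δ)) := by
  classical
  have hΔ := G.Δ_pos
  set S := {v | |G.idealBid μ v i - G.competingBid (G.idealBid μ v) i| ≤ η} with hS
  have hSm : MeasurableSet S := G.measurableSet_tie μ i η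
  rw [← lintegral_indicator_one hSm]
  set C := ENNReal.ofReal (G.νhi * (2 * η * μ i / G.Δ))
  calc ∫⁻ v, S.indicator 1 v ∂G.profileLaw ≤ ∫⁻ _, C ∂G.profileLaw := ?_
    _ = C := by simp
  unfold profileLaw
  -- Only coordinate i is integrated out. With the other valuations fixed the competing bid is a
  -- constant d, and near ties confine the valuation of i to an interval of length 2ημ_i/Δ.
  refine lintegral_le_of_lmarginal_le {i} (measurable_one.indicator hSm) measurable_const ?_
  intro x
  rw [lmarginal_singleton, lmarginal_singleton]
  set d := G.competingBid (G.idealBid μ x) i with hd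
  set J : Set ℝ := Set.Icc ((d - η) * μ i / G.Δ) ((d + η) * μ i / G.Δ) with hJ
  have key : ∀ y, S.indicator (1 : (Fin N → ℝ) → ENNReal) (Function.update x i y)
      ≤ J.indicator 1 y := by
    intro y
    have hcomp : G.competingBid (G.idealBid μ (Function.update x i y)) i = d :=
      G.competingBid_congr fun j hj => by simp [idealBid, Function.update_of_ne hj]
    by_cases hy : Function.update x i y ∈ S
    · have hyJ : y ∈ J := by
        have h1 : |G.Δ * y / μ i - d| ≤ η := by
          have := hy
          rw [hS, Set.mem_ofPred_eq, hcomp] at this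
          simpa [idealBid] using this
        rw [abs_le] at h1
        constructor
        · rw [div_le_iff₀ hΔ, ← le_div_iff₀ hμ, mul_comm y]
          linarith [h1.1]
        · rw [le_div_iff₀ hΔ, ← div_le_iff₀ hμ, mul_comm y]
          linarith [h1.2]
      simp [hy, hyJ]
    · simp [hy]
  calc ∫⁻ y, S.indicator 1 (Function.update x i y) ∂G.valuation i
      ≤ ∫⁻ y, J.indicator 1 y ∂G.valuation i := lintegral_mono key
    _ = G.valuation i J := lintegral_indicator_one measurableSet_Icc
    _ ≤ ENNReal.ofReal G.νhi * volume J := G.valuation_le i measurableSet_Icc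
    _ = C := by
        rw [hJ, Real.volume_Icc, ← ENNReal.ofReal_mul G.νhi_pos.le]
        congr 2
        field_simp
        ring
    _ = ∫⁻ _, C ∂G.valuation i := by simp

theorem competingBid_le {b : Fin N → ℝ} {M : ℝ} (hb : ∀ j, b j ≤ M) (i : Fin N) :
    G.competingBid b i ≤ M := by
  have h := (le_kthLargest_iff G.one_le_γ (G.γ_le_card_erase i) b _).1 le_rfl
  have hpos := lt_of_lt_of_le Nat.zero_lt_one (G.one_le_γ.trans h)
  obtain ⟨j, hj⟩ := Finset.card_pos.1 hpos
  exact (Finset.mem_filter.1 hj).2.trans (hb j)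

/-- The own bid and the competing bid each move by at most η, so their order cannot change when they
differ by more than 2η. -/
theorem abs_win_sub_le {b b' : Fin N → ℝ} {η : ℝ} (h : ∀ j, |b j - b' j| ≤ η) (i : Fin N) :
    |G.win b i - G.win b' i|
      ≤ {c : Fin N → ℝ | |c i - G.competingBid c i| ≤ 2 * η}.indicator (fun _ => 1) b := by
  by_cases hb : |b i - G.competingBid b i| ≤ 2 * η
  · rw [Set.indicator_of_mem (by exact hb), abs_le]
    constructor <;> linarith [G.win_nonneg b i, G.win_nonneg b' i, G.win_le_one b i,
      G.win_le_one b' i]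
  · rw [Set.indicator_of_notMem (by exact hb)]
    have h1 := abs_le.1 (h i)
    have h2 := abs_le.1 (G.abs_competingBid_sub_le h i)
    have : G.win b i = G.win b' i := by
      unfold win
      rcases lt_abs.1 (not_le.1 hb) with h3 | h3
      · rw [if_pos (by linarith), if_pos (by linarith)]
      · rw [if_neg (by linarith), if_neg (by linarith)]
    simp [this]

theorem abs_payment_sub_le {b b' : Fin N → ℝ} {η M : ℝ} (h : ∀ j, |b j - b' j| ≤ η)
    (h0 : ∀ j, 0 ≤ b' j) (hM : ∀ j, b' j ≤ M) (i : Fin N) :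
    |G.payment b i - G.payment b' i| ≤ η + M * |G.win b i - G.win b' i| := by
  have e : G.payment b i - G.payment b' i
      = G.win b i * (G.competingBid b i - G.competingBid b' i)
        + (G.win b i - G.win b' i) * G.competingBid b' i := by
    unfold payment; ring
  have hd := G.abs_competingBid_sub_le h i
  rw [e]
  refine (abs_add_le _ _).trans (add_le_add ?_ ?_)
  · rw [abs_mul, abs_of_nonneg (G.win_nonneg b i)]
    exact (mul_le_of_le_one_left (abs_nonneg _) (G.win_le_one b i)).trans hd
  · rw [abs_mul, mul_comm, abs_of_nonneg (G.competingBid_nonneg h0 i)]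
    exact mul_le_mul_of_nonneg_right (G.competingBid_le hM i) (abs_nonneg _)

theorem measurable_win_idealBid (μ : Fin N → ℝ) (i : Fin N) :
    Measurable fun v => G.win (G.idealBid μ v) i :=
  (G.measurable_win i).comp (G.measurable_idealBid μ)

theorem measurable_payment_idealBid (μ : Fin N → ℝ) (i : Fin N) :
    Measurable fun v => G.payment (G.idealBid μ v) i :=
  (G.measurable_payment i).comp (G.measurable_idealBid μ)

theorem payment_idealBid_mem_Icc {μ v : Fin N → ℝ} (hμ : μ ∈ G.closedBox)
    (hv : ∀ j, v j ∈ Set.Icc (0 : ℝ) 1) (i : Fin N) :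
    G.payment (G.idealBid μ v) i ∈ Set.Icc 0 G.maxBid :=
  ⟨G.payment_nonneg (G.idealBid_nonneg hμ hv) i,
    (G.payment_le_bid (G.idealBid_nonneg hμ hv) i).trans (G.idealBid_le_maxBid hμ hv i)⟩

theorem integrable_payment_idealBid {μ : Fin N → ℝ} (hμ : μ ∈ G.closedBox) (i : Fin N) :
    Integrable (fun v => G.payment (G.idealBid μ v) i) G.profileLaw := by
  refine Integrable.of_bound (G.measurable_payment_idealBid μ i).aestronglyMeasurable G.maxBid ?_
  filter_upwards [G.ae_profileLaw] with v hv
  have h := G.payment_idealBid_mem_Icc hμ hv i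
  rw [Real.norm_eq_abs, abs_of_nonneg h.1]
  exact h.2

theorem expenditure_mem_Icc {μ : Fin N → ℝ} (hμ : μ ∈ G.closedBox) (i : Fin N) :
    G.expenditure i μ ∈ Set.Icc 0 G.maxBid := by
  rw [G.expenditure_eq (G.pos_of_mem_closedBox hμ)]
  constructor
  · refine integral_nonneg_of_ae ?_
    filter_upwards [G.ae_profileLaw] with v hv using (G.payment_idealBid_mem_Icc hμ hv i).1
  · calc ∫ v, G.payment (G.idealBid μ v) i ∂G.profileLaw ≤ ∫ _, G.maxBid ∂G.profileLaw := by
          refine integral_mono_ae (G.integrable_payment_idealBid hμ i) (integrable_const _) ?_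
          filter_upwards [G.ae_profileLaw] with v hv using (G.payment_idealBid_mem_Icc hμ hv i).2
      _ = G.maxBid := by simp

/-- The Lipschitz constant of the expected allocation in the multipliers. -/
noncomputable def allocLip : ℝ := 4 * G.νhi * G.μhi / G.μlo ^ 2

theorem μhi_pos : 0 < G.μhi := G.μlo_pos.trans G.μlo_lt_μhi

theorem allocLip_pos : 0 < G.allocLip := by
  have h1 := G.νhi_pos
  have h2 := G.μlo_pos
  have h3 := G.μhi_pos
  unfold allocLip
  positivity

theorem integrable_abs_win_sub (μ μ' : Fin N → ℝ) (i : Fin N) :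
    Integrable (fun v => |G.win (G.idealBid μ v) i - G.win (G.idealBid μ' v) i|)
      G.profileLaw := by
  refine Integrable.of_bound (C := 1) ((G.measurable_win_idealBid μ i).sub
    (G.measurable_win_idealBid μ' i)).abs.aestronglyMeasurable (Filter.Eventually.of_forall ?_)
  intro v
  rw [Real.norm_eq_abs, abs_abs, abs_le]
  constructor <;> linarith [G.win_nonneg (G.idealBid μ v) i, G.win_nonneg (G.idealBid μ' v) i,
    G.win_le_one (G.idealBid μ v) i, G.win_le_one (G.idealBid μ' v) i]

theorem abs_idealBid_sub_le_of_le {μ μ' v : Fin N → ℝ} (hμ : μ ∈ G.closedBox)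
    (hμ' : μ' ∈ G.closedBox) (hv : ∀ j, v j ∈ Set.Icc (0 : ℝ) 1) {e : ℝ}
    (h : ∀ j, |μ j - μ' j| ≤ e) (j : Fin N) :
    |G.idealBid μ v j - G.idealBid μ' v j| ≤ G.Δ / G.μlo ^ 2 * e :=
  (G.abs_idealBid_sub_le hμ hμ' hv j).trans
    (mul_le_mul_of_nonneg_left (h j) (div_nonneg G.Δ_pos.le (sq_nonneg _)))

/-- A change e of the multipliers moves bids by at most η = Δe/μlo², so only ties within 2η matter.
Their probability is proportional to η/Δ, hence Δ cancels in `allocLip`. -/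
theorem integral_abs_win_sub_le {μ μ' : Fin N → ℝ} (hμ : μ ∈ G.closedBox)
    (hμ' : μ' ∈ G.closedBox) {e : ℝ} (he : 0 ≤ e) (h : ∀ j, |μ j - μ' j| ≤ e) (i : Fin N) :
    ∫ v, |G.win (G.idealBid μ v) i - G.win (G.idealBid μ' v) i| ∂G.profileLaw
      ≤ G.allocLip * e := by
  have hΔ := G.Δ_pos
  have hlo := G.μlo_pos
  have hν := G.νhi_pos
  set η := G.Δ / G.μlo ^ 2 * e with hη
  have hη0 : 0 ≤ η := by positivity
  set S := {v | |G.idealBid μ v i - G.competingBid (G.idealBid μ v) i| ≤ 2 * η} with hS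
  have hSm : MeasurableSet S := G.measurableSet_tie μ i _
  calc ∫ v, |G.win (G.idealBid μ v) i - G.win (G.idealBid μ' v) i| ∂G.profileLaw
      ≤ ∫ v, S.indicator (fun _ => (1 : ℝ)) v ∂G.profileLaw := by
        refine integral_mono_ae (G.integrable_abs_win_sub μ μ' i)
          ((integrable_const _).indicator hSm) ?_
        filter_upwards [G.ae_profileLaw] with v hv
        exact G.abs_win_sub_le (G.abs_idealBid_sub_le_of_le hμ hμ' hv h) i
    _ = G.profileLaw.real S := by
        rw [integral_indicator hSm, setIntegral_const, smul_eq_mul, mul_one]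
    _ ≤ G.νhi * (2 * (2 * η) * μ i / G.Δ) := by
        have hp := G.pos_of_mem_closedBox hμ i
        refine ENNReal.toReal_le_of_le_ofReal (by positivity) ?_
        exact G.profileLaw_tie_le i hp
    _ ≤ G.νhi * (2 * (2 * η) * G.μhi / G.Δ) := by
        have := (hμ i).2
        gcongr
    _ = G.allocLip * e := by
        rw [hη, allocLip]; field_simp; ring

theorem abs_expenditure_sub_le {μ μ' : Fin N → ℝ} (hμ : μ ∈ G.closedBox)
    (hμ' : μ' ∈ G.closedBox) {e : ℝ} (he : 0 ≤ e) (h : ∀ j, |μ j - μ' j| ≤ e) (i : Fin N) :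
    |G.expenditure i μ - G.expenditure i μ'|
      ≤ (G.Δ / G.μlo ^ 2 + G.maxBid * G.allocLip) * e := by
  rw [G.expenditure_eq (G.pos_of_mem_closedBox hμ), G.expenditure_eq (G.pos_of_mem_closedBox hμ'),
    ← integral_sub (G.integrable_payment_idealBid hμ i) (G.integrable_payment_idealBid hμ' i)]
  have hint := (G.integrable_abs_win_sub μ μ' i).const_mul G.maxBid
  calc |∫ v, (G.payment (G.idealBid μ v) i - G.payment (G.idealBid μ' v) i) ∂G.profileLaw|
      ≤ ∫ v, |G.payment (G.idealBid μ v) i - G.payment (G.idealBid μ' v) i| ∂G.profileLaw :=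
        abs_integral_le_integral_abs
    _ ≤ ∫ v, (G.Δ / G.μlo ^ 2 * e
          + G.maxBid * |G.win (G.idealBid μ v) i - G.win (G.idealBid μ' v) i|) ∂G.profileLaw := by
        refine integral_mono_ae ((G.integrable_payment_idealBid hμ i).sub
          (G.integrable_payment_idealBid hμ' i)).abs ((integrable_const _).add hint) ?_
        filter_upwards [G.ae_profileLaw] with v hv
        exact G.abs_payment_sub_le (G.abs_idealBid_sub_le_of_le hμ hμ' hv h)
          (G.idealBid_nonneg hμ' hv) (G.idealBid_le_maxBid hμ' hv) i
    _ = G.Δ / G.μlo ^ 2 * e + G.maxBid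
          * ∫ v, |G.win (G.idealBid μ v) i - G.win (G.idealBid μ' v) i| ∂G.profileLaw := by
        rw [integral_add (integrable_const _) hint]
        simp [integral_const_mul]
    _ ≤ _ := by
        have := mul_le_mul_of_nonneg_left (G.integral_abs_win_sub_le hμ hμ' he h i) G.maxBid_pos.le
        linarith

/-- The expected cost of agent `i` in one period without budget constraints. -/
noncomputable def expectedCost (i : Fin N) (μ : Fin N → ℝ) : ℝ :=
  ∫ v, G.cost v (G.idealBid μ v) i ∂G.profileLaw

theorem integrable_cost_idealBid (μ : Fin N → ℝ) (i : Fin N) :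
    Integrable (fun v => G.cost v (G.idealBid μ v) i) G.profileLaw := by
  refine Integrable.of_bound (C := 1) ((G.measurable_cost i).comp
    (measurable_id.prodMk (G.measurable_idealBid μ))).aestronglyMeasurable ?_
  filter_upwards [G.ae_profileLaw] with v hv
  have h := G.cost_mem_Icc (G.idealBid μ v) (hv i)
  rw [Real.norm_eq_abs, abs_of_nonneg h.1]
  exact h.2

theorem abs_expectedCost_sub_le {μ μ' : Fin N → ℝ} (hμ : μ ∈ G.closedBox)
    (hμ' : μ' ∈ G.closedBox) {e : ℝ} (he : 0 ≤ e) (h : ∀ j, |μ j - μ' j| ≤ e) (i : Fin N) :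
    |G.expectedCost i μ - G.expectedCost i μ'| ≤ G.allocLip * e := by
  unfold expectedCost
  rw [← integral_sub (G.integrable_cost_idealBid μ i) (G.integrable_cost_idealBid μ' i)]
  refine abs_integral_le_integral_abs.trans (le_trans ?_
    (G.integral_abs_win_sub_le hμ hμ' he h i))
  refine integral_mono_ae ((G.integrable_cost_idealBid μ i).sub
    (G.integrable_cost_idealBid μ' i)).abs (G.integrable_abs_win_sub μ μ' i) ?_
  filter_upwards [G.ae_profileLaw] with v hv
  have e1 : G.cost v (G.idealBid μ v) i - G.cost v (G.idealBid μ' v) i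
      = -(v i * G.Δ) * (G.win (G.idealBid μ v) i - G.win (G.idealBid μ' v) i) := by
    unfold cost; ring
  show |G.cost v (G.idealBid μ v) i - G.cost v (G.idealBid μ' v) i| ≤ _
  rw [e1, abs_mul, abs_neg, abs_of_nonneg (mul_nonneg (hv i).1 G.Δ_pos.le)]
  exact mul_le_of_le_one_left (abs_nonneg _)
    (mul_le_one₀ (hv i).2 G.Δ_pos.le G.Δ_le_one)

theorem expectedCost_mem_Icc (i : Fin N) (μ : Fin N → ℝ) :
    G.expectedCost i μ ∈ Set.Icc (0 : ℝ) 1 := by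
  unfold expectedCost
  constructor
  · refine integral_nonneg_of_ae ?_
    filter_upwards [G.ae_profileLaw] with v hv using (G.cost_mem_Icc _ (hv i)).1
  · calc ∫ v, G.cost v (G.idealBid μ v) i ∂G.profileLaw ≤ ∫ _, 1 ∂G.profileLaw := by
          refine integral_mono_ae (G.integrable_cost_idealBid μ i) (integrable_const _) ?_
          filter_upwards [G.ae_profileLaw] with v hv using (G.cost_mem_Icc _ (hv i)).2
      _ = 1 := by simp

/-- At a stationary profile the dual objective is the expected cost. -/
theorem dualObjective_eq_expectedCost {μ : Fin N → ℝ} (hμ : μ ∈ G.closedBox)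
    (hs : G.IsStationary μ) (i : Fin N) : G.dualObjective i μ = G.expectedCost i μ := by
  have hp := G.pos_of_mem_closedBox hμ i
  have hZ : ∫ v, G.payment (G.idealBid μ v) i ∂G.profileLaw = G.ρ i := by
    rw [← G.expenditure_eq (G.pos_of_mem_closedBox hμ)]; exact hs.2 i
  -- The positive part equals x_i(Δv_i − μ_i d_i), so the integrand is the cost plus μ_i times
  -- payment minus ρ_i. The latter has mean zero at a stationary profile.
  have e : ∀ v : Fin N → ℝ, v i - μ i * G.ρ i
      - max (G.Δ * v i - μ i * G.competingBid (G.idealBid μ v) i) 0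
      = G.cost v (G.idealBid μ v) i + (μ i * G.payment (G.idealBid μ v) i - μ i * G.ρ i) := by
    intro v
    have hb : μ i * G.idealBid μ v i = G.Δ * v i := by unfold idealBid; field_simp
    unfold cost payment win
    split_ifs with h
    · rw [max_eq_left (by rw [← hb]; nlinarith)]; ring
    · rw [max_eq_right (by rw [← hb]; nlinarith)]; ring
  have hi := (G.integrable_payment_idealBid hμ i).const_mul (μ i)
  have hi' : Integrable (fun v => μ i * G.payment (G.idealBid μ v) i - μ i * G.ρ i)
      G.profileLaw := hi.sub (integrable_const _)
  unfold dualObjective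
  simp only [e]
  rw [integral_add (G.integrable_cost_idealBid μ i) hi', integral_sub hi (integrable_const _), integral_const_mul, hZ, expectedCost]
  simp

/-- Strong monotonicity extends to the closed box by continuity. -/
theorem StronglyMonotone.closedBox {lam : ℝ} (hG : G.StronglyMonotone lam) {μ μ' : Fin N → ℝ}
    (hμ : μ ∈ G.closedBox) (hμ' : μ' ∈ G.openBox) :
    ∑ i, (μ i - μ' i) * (G.expenditure i μ - G.expenditure i μ')
      ≤ -lam * ∑ i, (μ i - μ' i) ^ 2 := by
  -- Projected multipliers may lie on the boundary of the box, where the hypothesis says nothing.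
  -- Moving slightly towards the interior point μ' enters the open box, and `abs_expenditure_sub_le`
  -- allows passing to the limit.
  have hmem : ∀ s ∈ Set.Ioo (0 : ℝ) 1, (fun i => μ i + s * (μ' i - μ i)) ∈ G.openBox := by
    intro s hs i
    have h1 := hμ i
    have h2 := hμ' i
    have h3 : μ i + s * (μ' i - μ i) = (1 - s) * μ i + s * μ' i := by ring
    show μ i + s * (μ' i - μ i) ∈ _
    rw [h3]
    constructor
    · nlinarith [mul_lt_mul_of_pos_left h2.1 hs.1,
        mul_le_mul_of_nonneg_left h1.1 (sub_nonneg.2 hs.2.le)]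
    · nlinarith [mul_lt_mul_of_pos_left h2.2 hs.1,
        mul_le_mul_of_nonneg_left h1.2 (sub_nonneg.2 hs.2.le)]
  have hle : ∀ᶠ s in nhdsWithin (0 : ℝ) (Set.Ioi 0), s ∈ Set.Ioo (0 : ℝ) 1 :=
    Ioo_mem_nhdsGT one_pos
  have hid : Filter.Tendsto (fun s : ℝ => s) (nhdsWithin 0 (Set.Ioi 0)) (nhds 0) :=
    tendsto_nhdsWithin_of_tendsto_nhds Filter.tendsto_id
  have hlim : ∀ i, Filter.Tendsto (fun s : ℝ => μ i + s * (μ' i - μ i))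
      (nhdsWithin 0 (Set.Ioi 0)) (nhds (μ i)) := by
    intro i
    simpa using (hid.mul_const (μ' i - μ i)).const_add (μ i)
  have hZ : ∀ i, Filter.Tendsto (fun s : ℝ => G.expenditure i fun j => μ j + s * (μ' j - μ j))
      (nhdsWithin 0 (Set.Ioi 0)) (nhds (G.expenditure i μ)) := by
    intro i
    rw [tendsto_iff_dist_tendsto_zero]
    set C := (G.Δ / G.μlo ^ 2 + G.maxBid * G.allocLip)
    refine squeeze_zero' (g := fun s => C * (s * (G.μhi - G.μlo)))
      (Filter.Eventually.of_forall fun _ => dist_nonneg) ?_ ?_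
    · filter_upwards [hle] with s hs
      rw [Real.dist_eq]
      refine G.abs_expenditure_sub_le (G.openBox_subset_closedBox (hmem s hs)) hμ
        (mul_nonneg hs.1.le (sub_nonneg.2 G.μlo_lt_μhi.le)) (fun j => ?_) i
      have h1 := hμ j
      have h2 := hμ' j
      rw [add_sub_cancel_left, abs_mul, abs_of_pos hs.1]
      refine mul_le_mul_of_nonneg_left (abs_le.2 ⟨?_, ?_⟩) hs.1.le <;>
        linarith [h1.1, h1.2, h2.1, h2.2]
    · simpa using (hid.mul_const (G.μhi - G.μlo)).const_mul C
  refine le_of_tendsto_of_tendsto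
    (tendsto_finsetSum _ fun i _ => ((hlim i).sub_const (μ' i)).mul ((hZ i).sub_const _))
    ((tendsto_finsetSum _ fun i _ => ((hlim i).sub_const (μ' i)).pow 2).const_mul (-lam)) ?_
  filter_upwards [hle] with s hs using hG _ (hmem s hs) _ hμ'

end PacingGame

/-! ### Measurability of the dynamics and independence from current valuations. -/

namespace PacingGame

variable {N : ℕ} (G : PacingGame N)

theorem measurable_pacingBid {Ω : Type*} [MeasurableSpace Ω] {m k w : Ω → Fin N → ℝ}
    (hm : Measurable m) (hk : Measurable k) (hw : Measurable w) :
    Measurable fun x => G.pacingBid ⟨m x, k x⟩ (w x) := by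
  rw [measurable_pi_iff] at hm hk hw ⊢
  exact fun j => (((hw j).const_mul G.Δ).div (hm j)).min (hk j)

theorem measurable_step {Ω : Type*} [MeasurableSpace Ω] (ε : ℝ) {m k w : Ω → Fin N → ℝ}
    (hm : Measurable m) (hk : Measurable k) (hw : Measurable w) :
    Measurable (fun x => (G.step ε ⟨m x, k x⟩ (w x)).mult) ∧
      Measurable (fun x => (G.step ε ⟨m x, k x⟩ (w x)).budget) := by
  have hb := G.measurable_pacingBid hm hk hw
  have hp : ∀ i, Measurable fun x => G.payment (G.pacingBid ⟨m x, k x⟩ (w x)) i :=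
    fun i => (G.measurable_payment i).comp hb
  have hm' := measurable_pi_iff.1 hm
  have hk' := measurable_pi_iff.1 hk
  refine ⟨measurable_pi_iff.2 fun i => ?_, measurable_pi_iff.2 fun i => ?_⟩
  · exact (((hm' i).add (((hp i).sub_const _).const_mul ε)).max measurable_const).min
      measurable_const
  · exact (hk' i).sub (hp i)

theorem measurable_state (T : ℕ) (ε : ℝ) (μ₁ : Fin N → ℝ) (t : ℕ) :
    Measurable (fun v => (G.state T ε μ₁ v t).mult) ∧
      Measurable (fun v => (G.state T ε μ₁ v t).budget) := by
  induction t with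
  | zero => exact ⟨measurable_const, measurable_const⟩
  | succ t ih => exact G.measurable_step ε ih.1 ih.2 (measurable_pi_apply t)

theorem state_congr (T : ℕ) (ε : ℝ) (μ₁ : Fin N → ℝ) {v v' : ℕ → Fin N → ℝ} {t : ℕ}
    (h : ∀ s < t, v s = v' s) : G.state T ε μ₁ v t = G.state T ε μ₁ v' t := by
  induction t with
  | zero => rfl
  | succ t ih =>
    rw [state, state, ih fun s hs => h s (hs.trans t.lt_succ_self), h t t.lt_succ_self]

theorem indepFun_state (T : ℕ) (ε : ℝ) (μ₁ : Fin N → ℝ) (t : ℕ) :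
    ProbabilityTheory.IndepFun
      (fun v => ((G.state T ε μ₁ v t).mult, (G.state T ε μ₁ v t).budget)) (fun v => v t)
      G.pathLaw := by
  classical
  have h0 : ProbabilityTheory.iIndepFun (fun (s : ℕ) (v : ℕ → Fin N → ℝ) => v s) G.pathLaw :=
    ProbabilityTheory.iIndepFun_infinitePi (P := fun _ : ℕ => G.profileLaw)
      (X := fun _ => id) fun _ => measurable_id
  have h1 := h0.indepFun_finset (Finset.range t) {t} (by simp) fun s => measurable_pi_apply s
  -- Padding the first t profiles with zeros to a full path exhibits the state as a measurable
  -- function of those profiles alone.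
  let ext : (↥(Finset.range t) → Fin N → ℝ) → ℕ → Fin N → ℝ :=
    fun x s => if h : s ∈ Finset.range t then x ⟨s, h⟩ else 0
  have hext : Measurable ext := by
    refine measurable_pi_iff.2 fun s => ?_
    by_cases h : s ∈ Finset.range t
    · simp only [ext, h, dite_true]; exact measurable_pi_apply _
    · simp only [ext, h, dite_false]; exact measurable_const
  have hs := G.measurable_state T ε μ₁ t
  have h2 := h1.comp ((hs.1.comp hext).prodMk (hs.2.comp hext))
    (measurable_pi_apply (⟨t, Finset.mem_singleton_self t⟩ : ({t} : Finset ℕ)))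
  convert! h2 using 1
  ext1 v
  have : G.state T ε μ₁ v t
      = G.state T ε μ₁ (ext fun s : ↥(Finset.range t) => v s) t :=
    G.state_congr T ε μ₁ fun s hs => by simp [ext, hs]
  simp only [Function.comp_apply]
  rw [this]

/-- The current state is independent of the current valuations. -/
theorem integral_state (T : ℕ) (ε : ℝ) (μ₁ : Fin N → ℝ) (t : ℕ)
    {g : PacingState N → (Fin N → ℝ) → ℝ}
    (hg : Measurable fun p : ((Fin N → ℝ) × (Fin N → ℝ)) × (Fin N → ℝ) => g ⟨p.1.1, p.1.2⟩ p.2)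
    (hi : Integrable (fun v => g (G.state T ε μ₁ v t) (v t)) G.pathLaw) :
    ∫ v, g (G.state T ε μ₁ v t) (v t) ∂G.pathLaw
        = ∫ v, ∫ w, g (G.state T ε μ₁ v t) w ∂G.profileLaw ∂G.pathLaw
      ∧ Integrable (fun v => ∫ w, g (G.state T ε μ₁ v t) w ∂G.profileLaw) G.pathLaw := by
  have hs := G.measurable_state T ε μ₁ t
  have hS := hs.1.prodMk hs.2
  have hX : Measurable fun v : ℕ → Fin N → ℝ => v t := measurable_pi_apply t
  have hmap := (G.indepFun_state T ε μ₁ t).map_prod_eq_prod_map_map hS.aemeasurable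
    hX.aemeasurable
  have hlaw : G.pathLaw.map (fun v => v t) = G.profileLaw :=
    (measurePreserving_eval_infinitePi (fun _ : ℕ => G.profileLaw) t).map_eq
  rw [hlaw] at hmap
  have hi2 : Integrable
      (fun p : ((Fin N → ℝ) × (Fin N → ℝ)) × (Fin N → ℝ) => g ⟨p.1.1, p.1.2⟩ p.2)
      ((G.pathLaw.map fun v => ((G.state T ε μ₁ v t).mult, (G.state T ε μ₁ v t).budget)).prod
        G.profileLaw) := by
    rw [← hmap, integrable_map_measure hg.aestronglyMeasurable (hS.prodMk hX).aemeasurable]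
    exact hi
  have hp : IsProbabilityMeasure
      (G.pathLaw.map fun v => ((G.state T ε μ₁ v t).mult, (G.state T ε μ₁ v t).budget)) :=
    Measure.isProbabilityMeasure_map hS.aemeasurable
  constructor
  · have h1 := integral_map (μ := G.pathLaw) (hS.prodMk hX).aemeasurable hg.aestronglyMeasurable
    rw [hmap, integral_prod _ hi2, integral_map hS.aemeasurable
      hi2.integral_prod_left.aestronglyMeasurable] at h1
    exact h1.symm
  · have h2 := hi2.integral_prod_left
    rw [integrable_map_measure h2.aestronglyMeasurable hS.aemeasurable] at h2
    exact h2

/-- The set of states that the dynamics can reach. -/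
def Valid (s : PacingState N) : Prop := s.mult ∈ G.closedBox ∧ ∀ i, 0 ≤ s.budget i

/-- No agent can be constrained by the budget in the next period. -/
def Ample (s : PacingState N) : Prop := ∀ i, G.maxBid ≤ s.budget i

theorem proj_mem_Icc (x : ℝ) : G.proj x ∈ Set.Icc G.μlo G.μhi :=
  ⟨le_min (le_max_right _ _) G.μlo_lt_μhi.le, min_le_right _ _⟩

theorem sq_proj_sub_le (x : ℝ) {y : ℝ} (hy : y ∈ Set.Icc G.μlo G.μhi) :
    (G.proj x - y) ^ 2 ≤ (x - y) ^ 2 := by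
  obtain ⟨h1, h2⟩ := hy
  rw [sq_le_sq]
  unfold proj
  rcases le_total x G.μlo with h | h
  · rw [max_eq_right h, min_eq_left (h1.trans h2), abs_of_nonpos (by linarith),
      abs_of_nonpos (by linarith)]
    linarith
  · rw [max_eq_left h]
    rcases le_total x G.μhi with h' | h'
    · rw [min_eq_left h']
    · rw [min_eq_right h', abs_of_nonneg (by linarith), abs_of_nonneg (by linarith)]
      linarith

/-! ### Reachable states and ample budgets. -/

variable {G}

theorem Valid.pacingBid_nonneg {s : PacingState N} (hs : G.Valid s) {w : Fin N → ℝ}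
    (hw : ∀ i, w i ∈ Set.Icc (0 : ℝ) 1) (j : Fin N) : 0 ≤ G.pacingBid s w j :=
  le_min (G.idealBid_nonneg hs.1 hw j) (hs.2 j)

theorem Valid.payment_nonneg {s : PacingState N} (hs : G.Valid s) {w : Fin N → ℝ}
    (hw : ∀ i, w i ∈ Set.Icc (0 : ℝ) 1) (i : Fin N) : 0 ≤ G.payment (G.pacingBid s w) i :=
  G.payment_nonneg (hs.pacingBid_nonneg hw) i

theorem Valid.payment_le_div {s : PacingState N} (hs : G.Valid s) {w : Fin N → ℝ}
    (hw : ∀ i, w i ∈ Set.Icc (0 : ℝ) 1) (i : Fin N) :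
    G.payment (G.pacingBid s w) i ≤ G.Δ / s.mult i :=
  (G.payment_le_bid (hs.pacingBid_nonneg hw) i).trans
    ((min_le_left _ _).trans (G.idealBid_le_div hs.1 hw i))

theorem Valid.payment_le_maxBid {s : PacingState N} (hs : G.Valid s) {w : Fin N → ℝ}
    (hw : ∀ i, w i ∈ Set.Icc (0 : ℝ) 1) (i : Fin N) :
    G.payment (G.pacingBid s w) i ≤ G.maxBid :=
  (hs.payment_le_div hw i).trans (G.div_le_maxBid hs.1 i)

theorem Valid.step {s : PacingState N} (hs : G.Valid s) {w : Fin N → ℝ}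
    (hw : ∀ i, w i ∈ Set.Icc (0 : ℝ) 1) (ε : ℝ) : G.Valid (G.step ε s w) := by
  refine ⟨fun i => G.proj_mem_Icc _, fun i => ?_⟩
  have := (G.payment_le_bid (hs.pacingBid_nonneg hw) i).trans (min_le_right _ _)
  exact sub_nonneg.2 this

/-- Payments are nonnegative, so budgets never grow. Along a path the ample periods therefore form
an initial segment. -/
theorem Ample.of_step {s : PacingState N} (hs : G.Valid s) {w : Fin N → ℝ}
    (hw : ∀ i, w i ∈ Set.Icc (0 : ℝ) 1) {ε : ℝ} (h : G.Ample (G.step ε s w)) : G.Ample s :=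
  fun i => (h i).trans (sub_le_self _ (hs.payment_nonneg hw i))

theorem Ample.pacingBid_eq {s : PacingState N} (ha : G.Ample s) (hs : G.Valid s) {w : Fin N → ℝ}
    (hw : ∀ i, w i ∈ Set.Icc (0 : ℝ) 1) : G.pacingBid s w = G.idealBid s.mult w := by
  ext j
  exact min_eq_left ((G.idealBid_le_maxBid hs.1 hw j).trans (ha j))

theorem valid_state (T : ℕ) (ε : ℝ) {μ₁ : Fin N → ℝ} (hμ₁ : μ₁ ∈ G.closedBox)
    {v : ℕ → Fin N → ℝ} (hv : ∀ t i, v t i ∈ Set.Icc (0 : ℝ) 1) (t : ℕ) :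
    G.Valid (G.state T ε μ₁ v t) := by
  induction t with
  | zero => exact ⟨hμ₁, fun i => mul_nonneg (G.ρ_pos i).le (Nat.cast_nonneg T)⟩
  | succ t ih => exact ih.step (hv t) ε

/-- The squared distance of the multipliers in state `s` to `μ'`. -/
def sqDist (s : PacingState N) (μ' : Fin N → ℝ) : ℝ := ∑ i, (s.mult i - μ' i) ^ 2

open Classical in
/-- The indicator of `Ample`. -/
noncomputable def ampleInd (G : PacingGame N) (s : PacingState N) : ℝ := if G.Ample s then 1 else 0

theorem sqDist_nonneg (s : PacingState N) (μ' : Fin N → ℝ) : 0 ≤ sqDist s μ' :=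
  Finset.sum_nonneg fun _ _ => sq_nonneg _

theorem Valid.sqDist_le {s : PacingState N} (hs : G.Valid s) {μ' : Fin N → ℝ}
    (hμ' : μ' ∈ G.closedBox) : sqDist s μ' ≤ N * (G.μhi - G.μlo) ^ 2 := by
  have h : ∀ i ∈ Finset.univ, (s.mult i - μ' i) ^ 2 ≤ (G.μhi - G.μlo) ^ 2 := fun i _ => by
    have h1 := hs.1 i
    have h2 := hμ' i
    exact sq_le_sq' (by linarith [h1.1, h2.2]) (by linarith [h1.2, h2.1])
  simpa [sqDist] using Finset.sum_le_card_nsmul _ _ _ h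

theorem ampleInd_nonneg (s : PacingState N) : 0 ≤ G.ampleInd s := by
  unfold ampleInd; split_ifs <;> norm_num

theorem ampleInd_le_one (s : PacingState N) : G.ampleInd s ≤ 1 := by
  unfold ampleInd; split_ifs <;> norm_num

theorem measurable_ampleInd {Ω : Type*} [MeasurableSpace Ω] {m k : Ω → Fin N → ℝ}
    (hk : Measurable k) : Measurable fun x => G.ampleInd ⟨m x, k x⟩ := by
  refine Measurable.ite ?_ measurable_const measurable_const
  have : {x | G.Ample ⟨m x, k x⟩} = ⋂ i, {x | G.maxBid ≤ k x i} := by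
    ext x; simp [Ample]
  rw [this]
  exact MeasurableSet.iInter fun i =>
    measurableSet_le measurable_const ((measurable_pi_apply i).comp hk)

theorem measurable_sqDist {Ω : Type*} [MeasurableSpace Ω] {m : Ω → Fin N → ℝ} (k : Ω → Fin N → ℝ)
    (hm : Measurable m) (μ' : Fin N → ℝ) : Measurable fun x => sqDist ⟨m x, k x⟩ μ' := by
  rw [measurable_pi_iff] at hm
  exact Finset.measurable_sum _ fun i _ => ((hm i).sub_const _).pow_const 2

theorem integrable_sqDist (T : ℕ) (ε : ℝ) {μ₁ μ' : Fin N → ℝ} (hμ₁ : μ₁ ∈ G.closedBox)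
    (hμ' : μ' ∈ G.closedBox) (t : ℕ) :
    Integrable (fun v => sqDist (G.state T ε μ₁ v t) μ') G.pathLaw := by
  have hs := G.measurable_state T ε μ₁ t
  refine Integrable.of_bound (C := N * (G.μhi - G.μlo) ^ 2)
    (measurable_sqDist (fun v => (G.state T ε μ₁ v t).budget) hs.1 μ').aestronglyMeasurable ?_
  filter_upwards [G.ae_pathLaw] with v hv
  rw [Real.norm_eq_abs, abs_of_nonneg (sqDist_nonneg _ _)]
  exact (valid_state T ε hμ₁ hv t).sqDist_le hμ'

theorem measurable_ampleInd_state (T : ℕ) (ε : ℝ) (μ₁ : Fin N → ℝ) (t : ℕ) :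
    Measurable fun v => G.ampleInd (G.state T ε μ₁ v t) :=
  measurable_ampleInd (m := fun v => (G.state T ε μ₁ v t).mult) (G.measurable_state T ε μ₁ t).2

theorem integrable_ampleInd_mul (T : ℕ) (ε : ℝ) (μ₁ : Fin N → ℝ) (t : ℕ)
    {f : (ℕ → Fin N → ℝ) → ℝ} (hf : Integrable f G.pathLaw) :
    Integrable (fun v => G.ampleInd (G.state T ε μ₁ v t) * f v) G.pathLaw := by
  refine hf.bdd_mul (c := 1) (measurable_ampleInd_state T ε μ₁ t).aestronglyMeasurable
    (Filter.Eventually.of_forall fun v => ?_)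
  rw [Real.norm_eq_abs, abs_of_nonneg (ampleInd_nonneg _)]
  exact ampleInd_le_one _

theorem integrable_ampleInd (T : ℕ) (ε : ℝ) (μ₁ : Fin N → ℝ) (t : ℕ) :
    Integrable (fun v => G.ampleInd (G.state T ε μ₁ v t)) G.pathLaw := by
  simpa using integrable_ampleInd_mul T ε μ₁ t (integrable_const (1 : ℝ))

/-! ### Contraction of the squared distance while budgets are ample. -/

theorem sqDist_step_le {s : PacingState N} (hs : G.Valid s) (ha : G.Ample s) {μ' w : Fin N → ℝ}
    (hμ' : μ' ∈ G.closedBox) (hρ : ∀ i, G.ρ i ≤ G.maxBid)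
    (hw : ∀ i, w i ∈ Set.Icc (0 : ℝ) 1) (ε : ℝ) :
    sqDist (G.step ε s w) μ' ≤ sqDist s μ' + N * (ε * G.maxBid) ^ 2
      + 2 * ε * ∑ i, (s.mult i - μ' i) * (G.payment (G.idealBid s.mult w) i - G.ρ i) := by
  have h : ∀ i, ((G.step ε s w).mult i - μ' i) ^ 2 ≤ (s.mult i - μ' i) ^ 2 + (ε * G.maxBid) ^ 2
      + 2 * ε * ((s.mult i - μ' i) * (G.payment (G.idealBid s.mult w) i - G.ρ i)) := by
    intro i
    have h1 := G.sq_proj_sub_le (s.mult i + ε * (G.payment (G.pacingBid s w) i - G.ρ i)) (hμ' i)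
    have hz0 := hs.payment_nonneg hw i
    have hz1 := hs.payment_le_maxBid hw i
    rw [ha.pacingBid_eq hs hw] at h1 hz0 hz1
    have hsq : (G.payment (G.idealBid s.mult w) i - G.ρ i) ^ 2 ≤ G.maxBid ^ 2 :=
      sq_le_sq' (by linarith [hρ i]) (by linarith [G.ρ_pos i])
    have h2 := mul_le_mul_of_nonneg_left hsq (sq_nonneg ε)
    show (G.proj (s.mult i + ε * (G.payment (G.pacingBid s w) i - G.ρ i)) - μ' i) ^ 2 ≤ _
    rw [ha.pacingBid_eq hs hw]
    refine h1.trans ?_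
    nlinarith
  refine (Finset.sum_le_sum fun i _ => h i).trans (le_of_eq ?_)
  rw [Finset.sum_add_distrib, Finset.sum_add_distrib, ← Finset.mul_sum]
  simp [sqDist]

/-- The expected squared distance contracts as long as budgets are ample. -/
theorem integral_sqDist_step_le {lam : ℝ} (hG : G.StronglyMonotone lam) {μ' : Fin N → ℝ}
    (hst : G.IsStationary μ') (hμ' : μ' ∈ G.openBox) {s : PacingState N} (hs : G.Valid s)
    (ha : G.Ample s) {ε : ℝ} (hε : 0 ≤ ε) :
    ∫ w, sqDist (G.step ε s w) μ' ∂G.profileLaw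
      ≤ (1 - 2 * (ε * lam)) * sqDist s μ' + N * (ε * G.maxBid) ^ 2 := by
  have hμc := G.openBox_subset_closedBox hμ'
  -- The target rate is the expenditure at the stationary profile, hence at most `maxBid`. Payment
  -- and rate thus lie in the same interval, which bounds the squared increment by (ε·maxBid)².
  have hρ : ∀ i, G.ρ i ≤ G.maxBid := fun i => by
    rw [← hst.2 i]; exact (G.expenditure_mem_Icc hμc i).2
  have hi : ∀ i ∈ Finset.univ, Integrable (fun w => (s.mult i - μ' i)
      * (G.payment (G.idealBid s.mult w) i - G.ρ i)) G.profileLaw := fun i _ =>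
    ((G.integrable_payment_idealBid hs.1 i).sub (integrable_const _)).const_mul _
  have hint := integrable_finsetSum _ hi
  have hI : ∫ w, ∑ i, (s.mult i - μ' i) * (G.payment (G.idealBid s.mult w) i - G.ρ i)
        ∂G.profileLaw
      = ∑ i, (s.mult i - μ' i) * (G.expenditure i s.mult - G.expenditure i μ') := by
    rw [integral_finsetSum _ hi]
    refine Finset.sum_congr rfl fun i _ => ?_
    rw [integral_const_mul, integral_sub (G.integrable_payment_idealBid hs.1 i)
      (integrable_const _), hst.2 i, G.expenditure_eq (G.pos_of_mem_closedBox hs.1)]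
    simp
  have hmeas : Measurable fun w => sqDist (G.step ε s w) μ' :=
    measurable_sqDist (fun w => (G.step ε s w).budget)
      (G.measurable_step ε (measurable_const (a := s.mult)) (measurable_const (a := s.budget))
        measurable_id).1 μ'
  calc ∫ w, sqDist (G.step ε s w) μ' ∂G.profileLaw
      ≤ ∫ w, (sqDist s μ' + N * (ε * G.maxBid) ^ 2
        + 2 * ε * ∑ i, (s.mult i - μ' i) * (G.payment (G.idealBid s.mult w) i - G.ρ i))
          ∂G.profileLaw := by
        refine integral_mono_ae ?_ ((integrable_const _).add (hint.const_mul _)) ?_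
        · refine Integrable.of_bound (C := N * (G.μhi - G.μlo) ^ 2)
            hmeas.aestronglyMeasurable ?_
          filter_upwards [G.ae_profileLaw] with w hw
          rw [Real.norm_eq_abs, abs_of_nonneg (sqDist_nonneg _ _)]
          exact (hs.step hw ε).sqDist_le hμc
        · filter_upwards [G.ae_profileLaw] with w hw using sqDist_step_le hs ha hμc hρ hw ε
    _ = sqDist s μ' + N * (ε * G.maxBid) ^ 2
        + 2 * ε * ∑ i, (s.mult i - μ' i) * (G.expenditure i s.mult - G.expenditure i μ') := by
        rw [integral_add (integrable_const _) (hint.const_mul _), integral_const_mul, hI]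
        simp
    _ ≤ _ := by
        have := mul_le_mul_of_nonneg_left (StronglyMonotone.closedBox G hG hs.1 hμ')
          (by positivity : 0 ≤ 2 * ε)
        have e : sqDist s μ' = ∑ i, (s.mult i - μ' i) ^ 2 := rfl
        rw [← e] at this
        linarith

/-- The expected squared distance in period `t`, on the event that budgets are ample. -/
noncomputable def ampleSqDist (G : PacingGame N) (T : ℕ) (ε : ℝ) (μ₁ μ' : Fin N → ℝ) (t : ℕ) : ℝ :=
  ∫ v, G.ampleInd (G.state T ε μ₁ v t) * sqDist (G.state T ε μ₁ v t) μ' ∂G.pathLaw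

theorem ampleSqDist_nonneg (T : ℕ) (ε : ℝ) (μ₁ μ' : Fin N → ℝ) (t : ℕ) :
    0 ≤ G.ampleSqDist T ε μ₁ μ' t :=
  integral_nonneg fun _ => mul_nonneg (ampleInd_nonneg _) (sqDist_nonneg _ _)

theorem ampleSqDist_zero_le (T : ℕ) (ε : ℝ) {μ₁ μ' : Fin N → ℝ} (hμ₁ : μ₁ ∈ G.closedBox)
    (hμ' : μ' ∈ G.closedBox) :
    G.ampleSqDist T ε μ₁ μ' 0 ≤ N * (G.μhi - G.μlo) ^ 2 := by
  unfold ampleSqDist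
  calc _ ≤ ∫ _, N * (G.μhi - G.μlo) ^ 2 ∂G.pathLaw := by
        refine integral_mono_ae (integrable_ampleInd_mul T ε μ₁ 0
          (integrable_sqDist T ε hμ₁ hμ' 0)) (integrable_const _) ?_
        filter_upwards [G.ae_pathLaw] with v hv
        exact (mul_le_of_le_one_left (sqDist_nonneg _ _) (ampleInd_le_one _)).trans
          ((valid_state T ε hμ₁ hv 0).sqDist_le hμ')
    _ = _ := by simp

theorem ampleSqDist_succ_le {lam : ℝ} (hG : G.StronglyMonotone lam) {μ₁ μ' : Fin N → ℝ}
    (hst : G.IsStationary μ') (hμ' : μ' ∈ G.openBox) (hμ₁ : μ₁ ∈ G.closedBox) (T : ℕ) {ε : ℝ}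
    (hε : 0 ≤ ε) (t : ℕ) :
    G.ampleSqDist T ε μ₁ μ' (t + 1)
      ≤ (1 - 2 * (ε * lam)) * G.ampleSqDist T ε μ₁ μ' t + N * (ε * G.maxBid) ^ 2 := by
  have hμc := G.openBox_subset_closedBox hμ'
  have hint : Integrable (fun v => G.ampleInd (G.state T ε μ₁ v t)
      * sqDist (G.step ε (G.state T ε μ₁ v t) (v t)) μ') G.pathLaw :=
    integrable_ampleInd_mul T ε μ₁ t (integrable_sqDist T ε hμ₁ hμc (t + 1))
  have hgm : Measurable fun p : ((Fin N → ℝ) × (Fin N → ℝ)) × (Fin N → ℝ) =>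
      G.ampleInd ⟨p.1.1, p.1.2⟩ * sqDist (G.step ε ⟨p.1.1, p.1.2⟩ p.2) μ' :=
    (measurable_ampleInd (m := fun p : ((Fin N → ℝ) × (Fin N → ℝ)) × (Fin N → ℝ) => p.1.1)
      (by fun_prop)).mul (measurable_sqDist
        (fun p : ((Fin N → ℝ) × (Fin N → ℝ)) × (Fin N → ℝ) =>
          (G.step ε ⟨p.1.1, p.1.2⟩ p.2).budget)
        (G.measurable_step ε (by fun_prop) (by fun_prop) (by fun_prop)).1 μ')
  obtain ⟨h1, h2⟩ := G.integral_state T ε μ₁ t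
    (g := fun s w => G.ampleInd s * sqDist (G.step ε s w) μ') hgm hint
  have hi1 := integrable_ampleInd_mul T ε μ₁ t (integrable_sqDist T ε hμ₁ hμc t)
  calc G.ampleSqDist T ε μ₁ μ' (t + 1)
      ≤ ∫ v, G.ampleInd (G.state T ε μ₁ v t)
          * sqDist (G.step ε (G.state T ε μ₁ v t) (v t)) μ' ∂G.pathLaw := by
        refine integral_mono_ae (integrable_ampleInd_mul T ε μ₁ (t + 1)
          (integrable_sqDist T ε hμ₁ hμc (t + 1))) hint ?_
        filter_upwards [G.ae_pathLaw] with v hv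
        -- The indicator of period t + 1 is dominated by that of period t, which depends on the
        -- state only and not on the profile v t. This lets the conditional expectation be taken
        -- under the indicator.
        refine mul_le_mul_of_nonneg_right ?_ (sqDist_nonneg _ _)
        by_cases h : G.Ample (G.state T ε μ₁ v (t + 1))
        · have h' := Ample.of_step (valid_state T ε hμ₁ hv t) (hv t) h
          simp [ampleInd, h, h']
        · simp only [ampleInd, h, if_false]; split_ifs <;> norm_num
    _ = ∫ v, ∫ w, G.ampleInd (G.state T ε μ₁ v t)
          * sqDist (G.step ε (G.state T ε μ₁ v t) w) μ' ∂G.profileLaw ∂G.pathLaw := h1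
    _ ≤ ∫ v, ((1 - 2 * (ε * lam)) * (G.ampleInd (G.state T ε μ₁ v t)
          * sqDist (G.state T ε μ₁ v t) μ') + N * (ε * G.maxBid) ^ 2) ∂G.pathLaw := by
        refine integral_mono_ae h2 ((hi1.const_mul _).add (integrable_const _)) ?_
        filter_upwards [G.ae_pathLaw] with v hv
        show ∫ w, G.ampleInd (G.state T ε μ₁ v t)
          * sqDist (G.step ε (G.state T ε μ₁ v t) w) μ' ∂G.profileLaw ≤ _
        rw [integral_const_mul]
        by_cases h : G.Ample (G.state T ε μ₁ v t)
        · simp only [ampleInd, h, if_true, one_mul]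
          exact integral_sqDist_step_le hG hst hμ' (valid_state T ε hμ₁ hv t) h hε
        · simp only [ampleInd, h, if_false, zero_mul, mul_zero, zero_add]
          positivity
    _ = _ := by
        rw [integral_add (hi1.const_mul _) (integrable_const _), integral_const_mul]
        simp [ampleSqDist]

end PacingGame

/-! ### Scalar recursions. -/

theorem sum_le_of_contraction {D : ℕ → ℝ} {a b : ℝ} (hD : ∀ t, 0 ≤ D t)
    (h : ∀ t, D (t + 1) ≤ (1 - 2 * a) * D t + b) (T : ℕ) :
    2 * a * ∑ t ∈ Finset.range T, D t ≤ D 0 + T * b := by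
  suffices H : 2 * a * ∑ t ∈ Finset.range T, D t + D T ≤ D 0 + T * b by linarith [hD T]
  induction T with
  | zero => simp
  | succ T ih =>
    rw [Finset.sum_range_succ]
    push_cast
    linarith [h T]

/-- With X = (1 − a)^t R, the induction step holds because ((1 − a)X + s)² − 2as² exceeds (1 − 2a)(X
+ s)² by a²X² + 2aXs. The bound on √D_t is geometric plus constant, so its sum over t is of order
R/a + Ts. -/
theorem le_sq_of_contraction {D : ℕ → ℝ} {a b R s : ℝ} (ha : 0 ≤ a) (ha1 : 2 * a ≤ 1) (hR : 0 ≤ R)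
    (hs : 0 ≤ s) (h0 : D 0 ≤ R ^ 2) (hb : b ≤ 2 * a * s ^ 2)
    (h : ∀ t, D (t + 1) ≤ (1 - 2 * a) * D t + b) (t : ℕ) :
    D t ≤ ((1 - a) ^ t * R + s) ^ 2 := by
  induction t with
  | zero => rw [pow_zero, one_mul]; nlinarith
  | succ t ih =>
    set X := (1 - a) ^ t * R with hX
    have hX0 : 0 ≤ X := mul_nonneg (pow_nonneg (by linarith) t) hR
    have e : (1 - a) ^ (t + 1) * R = (1 - a) * X := by rw [hX]; ring
    rw [e]
    have h1 : (1 - 2 * a) * D t ≤ ((1 - a) * X + s) ^ 2 - 2 * a * s ^ 2 := by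
      have := mul_le_mul_of_nonneg_left ih (by linarith : 0 ≤ 1 - 2 * a)
      nlinarith [mul_nonneg hX0 hs, mul_nonneg ha (mul_nonneg hX0 hs),
        mul_nonneg (sq_nonneg a) (sq_nonneg X)]
    linarith [h t]

theorem sum_geom_add_le {a R s : ℝ} (ha : 0 < a) (ha1 : a ≤ 1) (hR : 0 ≤ R) (T : ℕ) :
    ∑ t ∈ Finset.range T, ((1 - a) ^ t * R + s) ≤ R / a + T * s := by
  have h : (∑ t ∈ Finset.range T, (1 - a) ^ t) * a ≤ 1 := by
    have := geom_sum_mul (1 - a) T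
    have h2 : 0 ≤ (1 - a) ^ T := pow_nonneg (by linarith) T
    linarith
  rw [Finset.sum_add_distrib, ← Finset.sum_mul, Finset.sum_const, Finset.card_range, nsmul_eq_mul]
  have h3 : (∑ t ∈ Finset.range T, (1 - a) ^ t) * R ≤ R / a := by
    rw [le_div_iff₀ ha]
    nlinarith
  linarith

/-! ### Counting the periods in which budgets are not ample. -/

namespace PacingGame

variable {N : ℕ} {G : PacingGame N}

theorem sum_ampleSqDist_le {lam : ℝ} (hlam : 0 < lam) (hG : G.StronglyMonotone lam)
    {μ₁ μ' : Fin N → ℝ} (hst : G.IsStationary μ') (hμ' : μ' ∈ G.openBox) (hμ₁ : μ₁ ∈ G.closedBox)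
    (T : ℕ) {ε : ℝ} (hε : 0 < ε) :
    ∑ t ∈ Finset.range T, G.ampleSqDist T ε μ₁ μ' t
      ≤ N * ((G.μhi - G.μlo) ^ 2 / (2 * lam) * (1 / ε) + G.maxBid ^ 2 / (2 * lam) * (T * ε)) := by
  have h := sum_le_of_contraction (ampleSqDist_nonneg T ε μ₁ μ')
    (ampleSqDist_succ_le hG hst hμ' hμ₁ T hε.le) T
  have h0 := ampleSqDist_zero_le T ε hμ₁ (G.openBox_subset_closedBox hμ')
  have e : (N : ℝ) * ((G.μhi - G.μlo) ^ 2 / (2 * lam) * (1 / ε)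
      + G.maxBid ^ 2 / (2 * lam) * (T * ε))
      = (N * (G.μhi - G.μlo) ^ 2 + T * (N * (ε * G.maxBid) ^ 2)) / (2 * (ε * lam)) := by
    field_simp
  rw [e, le_div_iff₀ (by positivity)]
  linarith

/-- Up to an error of order `ε`, the multiplier increases by the step size times the excess
expenditure. -/
def TracksExpenditure (G : PacingGame N) (μ' : Fin N → ℝ) (κ ε : ℝ) : Prop :=
  ∀ s, G.Valid s → ∀ w : Fin N → ℝ, (∀ i, w i ∈ Set.Icc (0 : ℝ) 1) → ∀ i,
    s.mult i + ε * (G.payment (G.pacingBid s w) i - G.ρ i) - ε * (κ * (s.mult i - μ' i) ^ 2)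
      ≤ (G.step ε s w).mult i

/-- Divided by ε, the tracking inequality telescopes: past spending exceeds the target by at most
the rise of the multiplier over ε plus the charged squared distances. -/
theorem TracksExpenditure.le_budget {μ' : Fin N → ℝ} {κ ε : ℝ} (h : G.TracksExpenditure μ' κ ε)
    (hε : 0 < ε) {μ₁ : Fin N → ℝ} (hμ₁ : μ₁ ∈ G.closedBox) (T : ℕ)
    {v : ℕ → Fin N → ℝ} (hv : ∀ t i, v t i ∈ Set.Icc (0 : ℝ) 1) (i : Fin N) (t : ℕ) :
    G.ρ i * (T - t) - ((G.state T ε μ₁ v t).mult i - μ₁ i) / ε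
        - κ * ∑ s ∈ Finset.range t, ((G.state T ε μ₁ v s).mult i - μ' i) ^ 2
      ≤ (G.state T ε μ₁ v t).budget i := by
  induction t with
  | zero => simp [state]
  | succ t ih =>
    have h1 := h _ (valid_state T ε hμ₁ hv t) (v t) (hv t) i
    have e1 : (G.state T ε μ₁ v (t + 1)).budget i = (G.state T ε μ₁ v t).budget i
      - G.payment (G.pacingBid (G.state T ε μ₁ v t) (v t)) i := rfl
    have e2 : G.step ε (G.state T ε μ₁ v t) (v t) = G.state T ε μ₁ v (t + 1) := rfl
    rw [e2] at h1
    rw [Finset.sum_range_succ, e1]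
    push_cast
    set z := G.payment (G.pacingBid (G.state T ε μ₁ v t) (v t)) i
    have h2 : ((G.state T ε μ₁ v t).mult i - μ₁ i) / ε + (z - G.ρ i)
        - κ * ((G.state T ε μ₁ v t).mult i - μ' i) ^ 2
        ≤ ((G.state T ε μ₁ v (t + 1)).mult i - μ₁ i) / ε := by
      rw [le_div_iff₀ hε, sub_mul, add_mul, div_mul_cancel₀ _ hε.ne']
      linarith
    linarith

/-- Pathwise bound on the number of periods in which some budget is not ample. -/
theorem TracksExpenditure.sum_not_ample_le {μ' : Fin N → ℝ} {κ ε r : ℝ}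
    (h : G.TracksExpenditure μ' κ ε) (hε : 0 < ε) (hκ : 0 ≤ κ) (hr : 0 < r)
    (hrρ : ∀ i, r ≤ G.ρ i) {μ₁ : Fin N → ℝ} (hμ₁ : μ₁ ∈ G.closedBox) (T : ℕ)
    {v : ℕ → Fin N → ℝ} (hv : ∀ t i, v t i ∈ Set.Icc (0 : ℝ) 1) :
    ∑ t ∈ Finset.range T, (1 - G.ampleInd (G.state T ε μ₁ v t))
      ≤ ((G.μhi - G.μlo) / ε + G.maxBid + κ * ∑ t ∈ Finset.range T,
          G.ampleInd (G.state T ε μ₁ v t) * sqDist (G.state T ε μ₁ v t) μ') / r := by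
  classical
  have hw : 0 ≤ (G.μhi - G.μlo) / ε := div_nonneg (sub_nonneg.2 G.μlo_lt_μhi.le) hε.le
  have hterm : ∀ t, 0 ≤ G.ampleInd (G.state T ε μ₁ v t) * sqDist (G.state T ε μ₁ v t) μ' :=
    fun t => mul_nonneg (ampleInd_nonneg _) (sqDist_nonneg _ _)
  have hsum := Finset.sum_nonneg fun t (_ : t ∈ Finset.range T) => hterm t
  by_cases hex : ∃ t, t < T ∧ ¬ G.Ample (G.state T ε μ₁ v t)
  -- At the first non-ample period τ some agent i holds less than `maxBid`, yet `le_budget` leaves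
  -- it at least ρ_i(T − τ) minus controlled terms; this bounds T − τ. All earlier periods are
  -- ample, so their squared distances occur in the sum on the right.
  · set τ := Nat.find hex with hτ
    obtain ⟨hτT, hτA⟩ := Nat.find_spec hex
    rw [← hτ] at hτT hτA
    have hbefore : ∀ t < τ, G.Ample (G.state T ε μ₁ v t) := fun t ht => by
      by_contra hA
      exact Nat.find_min hex ht ⟨ht.trans hτT, hA⟩
    obtain ⟨i, hi⟩ := not_forall.1 hτA
    have hb := h.le_budget hε hμ₁ T hv i τ
    have hsq : ∑ s ∈ Finset.range τ, ((G.state T ε μ₁ v s).mult i - μ' i) ^ 2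
        ≤ ∑ t ∈ Finset.range T,
          G.ampleInd (G.state T ε μ₁ v t) * sqDist (G.state T ε μ₁ v t) μ' := by
      refine le_trans (Finset.sum_le_sum fun t ht => ?_) (Finset.sum_le_sum_of_subset_of_nonneg
        (Finset.range_mono hτT.le) fun t _ _ => hterm t)
      rw [ampleInd, if_pos (hbefore t (Finset.mem_range.1 ht)), one_mul]
      exact Finset.single_le_sum (f := fun j => ((G.state T ε μ₁ v t).mult j - μ' j) ^ 2)
        (fun j _ => sq_nonneg _) (Finset.mem_univ i)
    have hcount : ∑ t ∈ Finset.range T, (1 - G.ampleInd (G.state T ε μ₁ v t)) ≤ T - τ := by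
      rw [← Finset.sum_range_add_sum_Ico _ hτT.le, Finset.sum_eq_zero fun t ht => by
        rw [ampleInd, if_pos (hbefore t (Finset.mem_range.1 ht)), sub_self], zero_add]
      refine (Finset.sum_le_card_nsmul _ _ 1 fun t _ => ?_).trans ?_
      · linarith [ampleInd_nonneg (G := G) (G.state T ε μ₁ v t)]
      · rw [Nat.card_Ico, nsmul_eq_mul, mul_one, Nat.cast_sub hτT.le]
    refine hcount.trans ?_
    rw [le_div_iff₀ hr]
    have hτT' : (0 : ℝ) ≤ T - τ := sub_nonneg.2 (Nat.cast_le.2 hτT.le)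
    have hmul := mul_le_mul_of_nonneg_right (hrρ i) hτT'
    have hμ : ((G.state T ε μ₁ v τ).mult i - μ₁ i) / ε ≤ (G.μhi - G.μlo) / ε :=
      div_le_div_of_nonneg_right (by
        linarith [((valid_state T ε hμ₁ hv τ).1 i).2, (hμ₁ i).1]) hε.le
    have hκs := mul_le_mul_of_nonneg_left hsq hκ
    linarith [not_le.1 hi]
  · rw [Finset.sum_eq_zero fun t ht => by
      rw [ampleInd, if_pos (by
        by_contra hA; exact hex ⟨t, Finset.mem_range.1 ht, hA⟩), sub_self]]
    have := G.maxBid_pos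
    positivity

/-- The expected number of periods in which some budget is not ample. -/
noncomputable def expectedNotAmple (G : PacingGame N) (T : ℕ) (ε : ℝ) (μ₁ : Fin N → ℝ) : ℝ :=
  ∑ t ∈ Finset.range T, ∫ v, (1 - G.ampleInd (G.state T ε μ₁ v t)) ∂G.pathLaw

theorem TracksExpenditure.expectedNotAmple_le {μ' : Fin N → ℝ} {κ ε r : ℝ}
    (h : G.TracksExpenditure μ' κ ε) (hε : 0 < ε) (hκ : 0 ≤ κ) (hr : 0 < r)
    (hrρ : ∀ i, r ≤ G.ρ i) {μ₁ : Fin N → ℝ} (hμ₁ : μ₁ ∈ G.closedBox) (hμ' : μ' ∈ G.closedBox)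
    (T : ℕ) :
    G.expectedNotAmple T ε μ₁ ≤ ((G.μhi - G.μlo) / ε + G.maxBid
      + κ * ∑ t ∈ Finset.range T, G.ampleSqDist T ε μ₁ μ' t) / r := by
  have hi1 : ∀ t ∈ Finset.range T,
      Integrable (fun v => 1 - G.ampleInd (G.state T ε μ₁ v t)) G.pathLaw :=
    fun t _ => (integrable_const _).sub (integrable_ampleInd T ε μ₁ t)
  have hi2 : ∀ t ∈ Finset.range T, Integrable (fun v => G.ampleInd (G.state T ε μ₁ v t)
      * sqDist (G.state T ε μ₁ v t) μ') G.pathLaw :=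
    fun t _ => integrable_ampleInd_mul T ε μ₁ t (integrable_sqDist T ε hμ₁ hμ' t)
  have hi3 := (integrable_finsetSum _ hi2).const_mul κ
  unfold expectedNotAmple ampleSqDist
  rw [← integral_finsetSum _ hi1, ← integral_finsetSum _ hi2]
  calc _ ≤ ∫ v, ((G.μhi - G.μlo) / ε + G.maxBid + κ * ∑ t ∈ Finset.range T,
          G.ampleInd (G.state T ε μ₁ v t) * sqDist (G.state T ε μ₁ v t) μ') / r ∂G.pathLaw := by
        refine integral_mono_ae (integrable_finsetSum _ hi1)
          (((integrable_const _).add hi3).div_const r) ?_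
        filter_upwards [G.ae_pathLaw] with v hv
        exact h.sum_not_ample_le hε hκ hr hrρ hμ₁ T hv
    _ = _ := by
        rw [integral_div, integral_add (integrable_const _) hi3, integral_const_mul]
        simp

theorem integral_sqDist_le (T : ℕ) (ε : ℝ) {μ₁ μ' : Fin N → ℝ} (hμ₁ : μ₁ ∈ G.closedBox)
    (hμ' : μ' ∈ G.closedBox) (t : ℕ) :
    ∫ v, sqDist (G.state T ε μ₁ v t) μ' ∂G.pathLaw ≤ G.ampleSqDist T ε μ₁ μ' t
      + N * (G.μhi - G.μlo) ^ 2 * ∫ v, (1 - G.ampleInd (G.state T ε μ₁ v t)) ∂G.pathLaw := by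
  have hi1 : Integrable (fun v => 1 - G.ampleInd (G.state T ε μ₁ v t)) G.pathLaw :=
    (integrable_const _).sub (integrable_ampleInd T ε μ₁ t)
  have hi2 := integrable_ampleInd_mul T ε μ₁ t (integrable_sqDist T ε hμ₁ hμ' t)
  unfold ampleSqDist
  rw [← integral_const_mul, ← integral_add hi2 (hi1.const_mul _)]
  refine integral_mono_ae (integrable_sqDist T ε hμ₁ hμ' t) (hi2.add (hi1.const_mul _)) ?_
  filter_upwards [G.ae_pathLaw] with v hv
  have h1 := (valid_state T ε hμ₁ hv t).sqDist_le hμ'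
  have h2 := mul_le_mul_of_nonneg_left h1
    (sub_nonneg.2 (ampleInd_le_one (G := G) (G.state T ε μ₁ v t)))
  linarith

theorem avgSqDist_le (T : ℕ) (ε : ℝ) {μ₁ μ' : Fin N → ℝ} (hμ₁ : μ₁ ∈ G.closedBox)
    (hμ' : μ' ∈ G.closedBox) :
    G.avgSqDist T ε μ₁ μ' ≤ 1 / (T : ℝ) * (∑ t ∈ Finset.range T, G.ampleSqDist T ε μ₁ μ' t
      + N * (G.μhi - G.μlo) ^ 2 * G.expectedNotAmple T ε μ₁) := by
  unfold avgSqDist expectedNotAmple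
  refine mul_le_mul_of_nonneg_left ?_ (by positivity)
  rw [Finset.mul_sum, ← Finset.sum_add_distrib]
  exact Finset.sum_le_sum fun t _ => integral_sqDist_le T ε hμ₁ hμ' t

theorem avgSqDist_nonneg (T : ℕ) (ε : ℝ) (μ₁ μ' : Fin N → ℝ) : 0 ≤ G.avgSqDist T ε μ₁ μ' :=
  mul_nonneg (by positivity) (Finset.sum_nonneg fun _ _ =>
    integral_nonneg fun _ => Finset.sum_nonneg fun _ _ => sq_nonneg _)

theorem avgSqDist_le_diam {T : ℕ} (hT : 1 ≤ T) (ε : ℝ) {μ₁ μ' : Fin N → ℝ}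
    (hμ₁ : μ₁ ∈ G.closedBox) (hμ' : μ' ∈ G.closedBox) :
    G.avgSqDist T ε μ₁ μ' ≤ N * (G.μhi - G.μlo) ^ 2 := by
  have hT' : (0 : ℝ) < T := Nat.cast_pos.2 hT
  have h : ∀ t ∈ Finset.range T, ∫ v, sqDist (G.state T ε μ₁ v t) μ' ∂G.pathLaw
      ≤ N * (G.μhi - G.μlo) ^ 2 := fun t _ => by
    calc _ ≤ ∫ _, N * (G.μhi - G.μlo) ^ 2 ∂G.pathLaw := by
          refine integral_mono_ae (integrable_sqDist T ε hμ₁ hμ' t) (integrable_const _) ?_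
          filter_upwards [G.ae_pathLaw] with v hv
          exact (valid_state T ε hμ₁ hv t).sqDist_le hμ'
      _ = _ := by simp
  have h2 := Finset.sum_le_card_nsmul _ _ _ h
  rw [Finset.card_range, nsmul_eq_mul] at h2
  show 1 / (T : ℝ) * ∑ t ∈ Finset.range T, ∫ v, sqDist (G.state T ε μ₁ v t) μ' ∂G.pathLaw ≤ _
  rw [one_div, inv_mul_le_iff₀ hT']
  exact h2

/-! ### From multipliers to costs. -/

theorem integrable_cost (T : ℕ) (ε : ℝ) (μ₁ : Fin N → ℝ) (i : Fin N) (t : ℕ) :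
    Integrable (fun v => G.cost (v t) (G.pacingBid (G.state T ε μ₁ v t) (v t)) i) G.pathLaw := by
  have hs := G.measurable_state T ε μ₁ t
  have hb := G.measurable_pacingBid hs.1 hs.2 (measurable_pi_apply t)
  refine Integrable.of_bound (C := 1) ((G.measurable_cost i).comp
    ((measurable_pi_apply t).prodMk hb)).aestronglyMeasurable ?_
  filter_upwards [G.ae_pathLaw] with v hv
  have h := G.cost_mem_Icc (G.pacingBid (G.state T ε μ₁ v t) (v t)) (hv t i)
  rw [Real.norm_eq_abs, abs_of_nonneg h.1]
  exact h.2

theorem integral_cost_pacingBid_mem_Icc (s : PacingState N) (i : Fin N) :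
    ∫ w, G.cost w (G.pacingBid s w) i ∂G.profileLaw ∈ Set.Icc (0 : ℝ) 1 := by
  have hm : Measurable fun w => G.cost w (G.pacingBid s w) i :=
    (G.measurable_cost i).comp (measurable_id.prodMk
      (G.measurable_pacingBid (measurable_const (a := s.mult)) (measurable_const (a := s.budget))
        measurable_id))
  have hi : Integrable (fun w => G.cost w (G.pacingBid s w) i) G.profileLaw := by
    refine Integrable.of_bound (C := 1) hm.aestronglyMeasurable ?_
    filter_upwards [G.ae_profileLaw] with w hw
    have h := G.cost_mem_Icc (G.pacingBid s w) (hw i)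
    rw [Real.norm_eq_abs, abs_of_nonneg h.1]
    exact h.2
  constructor
  · refine integral_nonneg_of_ae ?_
    filter_upwards [G.ae_profileLaw] with w hw using (G.cost_mem_Icc _ (hw i)).1
  · calc _ ≤ ∫ _, (1 : ℝ) ∂G.profileLaw := by
          refine integral_mono_ae hi (integrable_const _) ?_
          filter_upwards [G.ae_profileLaw] with w hw using (G.cost_mem_Icc _ (hw i)).2
      _ = 1 := by simp

/-- For an ample state, Lipschitz continuity gives the distance √D, and √D ≤ (D/a + a)/2. This form
is linear in D, so it can be integrated over states, with a chosen later as a bound on the root of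
the mean. Otherwise two numbers of [0, 1] are compared. -/
theorem abs_integral_cost_sub_le {s : PacingState N} (hs : G.Valid s) {μ' : Fin N → ℝ}
    (hμ' : μ' ∈ G.closedBox) {a : ℝ} (ha : 0 < a) (i : Fin N) :
    |∫ w, G.cost w (G.pacingBid s w) i ∂G.profileLaw - G.expectedCost i μ'|
      ≤ G.allocLip * ((G.ampleInd s * sqDist s μ' / a + a) / 2) + (1 - G.ampleInd s) := by
  have hL := G.allocLip_pos
  by_cases h : G.Ample s
  · simp only [ampleInd, h, if_true, one_mul, sub_self, add_zero]
    have e1 : ∫ w, G.cost w (G.pacingBid s w) i ∂G.profileLaw = G.expectedCost i s.mult := by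
      refine integral_congr_ae ?_
      filter_upwards [G.ae_profileLaw] with w hw
      rw [h.pacingBid_eq hs hw]
    rw [e1]
    have hsq : ∀ j, |s.mult j - μ' j| ≤ √(sqDist s μ') := fun j => by
      rw [← Real.sqrt_sq_eq_abs]
      exact Real.sqrt_le_sqrt (Finset.single_le_sum (f := fun j => (s.mult j - μ' j) ^ 2)
        (fun j _ => sq_nonneg _) (Finset.mem_univ j))
    refine (G.abs_expectedCost_sub_le hs.1 hμ' (Real.sqrt_nonneg _) hsq i).trans
      (mul_le_mul_of_nonneg_left ?_ hL.le)
    have h2 := Real.sq_sqrt (sqDist_nonneg s μ')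
    rw [le_div_iff₀ two_pos, ← sub_le_iff_le_add, le_div_iff₀ ha]
    nlinarith [sq_nonneg (√(sqDist s μ') - a)]
  · simp only [ampleInd, h, if_false, zero_mul, zero_div, zero_add, sub_zero]
    have h1 := integral_cost_pacingBid_mem_Icc (G := G) s i
    have h2 := G.expectedCost_mem_Icc i μ'
    have h3 : 0 ≤ G.allocLip * (a / 2) := by positivity
    have h4 : |∫ w, G.cost w (G.pacingBid s w) i ∂G.profileLaw - G.expectedCost i μ'| ≤ 1 :=
      abs_le.2 ⟨by linarith [h1.1, h2.2], by linarith [h1.2, h2.1]⟩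
    linarith

theorem abs_integral_cost_state_sub_le (T : ℕ) (ε : ℝ) {μ₁ μ' : Fin N → ℝ}
    (hμ₁ : μ₁ ∈ G.closedBox) (hμ' : μ' ∈ G.closedBox) (i : Fin N) (t : ℕ) {a : ℝ} (ha : 0 < a)
    (hD : G.ampleSqDist T ε μ₁ μ' t ≤ a ^ 2) :
    |∫ v, G.cost (v t) (G.pacingBid (G.state T ε μ₁ v t) (v t)) i ∂G.pathLaw
        - G.expectedCost i μ'|
      ≤ G.allocLip * a + ∫ v, (1 - G.ampleInd (G.state T ε μ₁ v t)) ∂G.pathLaw := by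
  have hL := G.allocLip_pos
  have hgm : Measurable fun p : ((Fin N → ℝ) × (Fin N → ℝ)) × (Fin N → ℝ) =>
      G.cost p.2 (G.pacingBid ⟨p.1.1, p.1.2⟩ p.2) i :=
    (G.measurable_cost i).comp (measurable_snd.prodMk
      (G.measurable_pacingBid (by fun_prop) (by fun_prop) (by fun_prop)))
  obtain ⟨h1, h2⟩ := G.integral_state T ε μ₁ t (g := fun s w => G.cost w (G.pacingBid s w) i)
    hgm (integrable_cost T ε μ₁ i t)
  have hi1 : Integrable (fun v => 1 - G.ampleInd (G.state T ε μ₁ v t)) G.pathLaw :=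
    (integrable_const _).sub (integrable_ampleInd T ε μ₁ t)
  have hi2 := integrable_ampleInd_mul T ε μ₁ t (integrable_sqDist T ε hμ₁ hμ' t)
  have hi3 : Integrable (fun v => G.allocLip * ((G.ampleInd (G.state T ε μ₁ v t)
      * sqDist (G.state T ε μ₁ v t) μ' / a + a) / 2)) G.pathLaw :=
    (((hi2.div_const a).add (integrable_const a)).div_const 2).const_mul _
  have e : ∫ v, G.cost (v t) (G.pacingBid (G.state T ε μ₁ v t) (v t)) i ∂G.pathLaw
        - G.expectedCost i μ'
      = ∫ v, (∫ w, G.cost w (G.pacingBid (G.state T ε μ₁ v t) w) i ∂G.profileLaw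
        - G.expectedCost i μ') ∂G.pathLaw := by
    rw [h1, integral_sub h2 (integrable_const _)]
    simp
  rw [e]
  calc _ ≤ ∫ v, |∫ w, G.cost w (G.pacingBid (G.state T ε μ₁ v t) w) i ∂G.profileLaw
        - G.expectedCost i μ'| ∂G.pathLaw := abs_integral_le_integral_abs
    _ ≤ ∫ v, (G.allocLip * ((G.ampleInd (G.state T ε μ₁ v t)
          * sqDist (G.state T ε μ₁ v t) μ' / a + a) / 2)
          + (1 - G.ampleInd (G.state T ε μ₁ v t))) ∂G.pathLaw := by
        refine integral_mono_ae (h2.sub (integrable_const _)).abs (hi3.add hi1) ?_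
        filter_upwards [G.ae_pathLaw] with v hv
        exact abs_integral_cost_sub_le (valid_state T ε hμ₁ hv t) hμ' ha i
    _ = G.allocLip * ((G.ampleSqDist T ε μ₁ μ' t / a + a) / 2)
          + ∫ v, (1 - G.ampleInd (G.state T ε μ₁ v t)) ∂G.pathLaw := by
        rw [integral_add hi3 hi1, integral_const_mul, integral_div,
          integral_add (hi2.div_const a) (integrable_const _), integral_div]
        simp [ampleSqDist]
    _ ≤ _ := by
        have : G.ampleSqDist T ε μ₁ μ' t / a ≤ a := by
          rw [div_le_iff₀ ha, ← sq]; exact hD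
        have := mul_le_mul_of_nonneg_left (by linarith :
          (G.ampleSqDist T ε μ₁ μ' t / a + a) / 2 ≤ a) hL.le
        linarith

theorem strategicCost_eq_sum (T : ℕ) (ε : ℝ) (μ₁ : Fin N → ℝ) (i : Fin N) :
    G.strategicCost T ε μ₁ i = ∑ t ∈ Finset.range T,
      ∫ v, G.cost (v t) (G.pacingBid (G.state T ε μ₁ v t) (v t)) i ∂G.pathLaw :=
  integral_finsetSum _ fun t _ => integrable_cost T ε μ₁ i t

theorem strategicCost_mem_Icc (T : ℕ) (ε : ℝ) (μ₁ : Fin N → ℝ) (i : Fin N) :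
    G.strategicCost T ε μ₁ i ∈ Set.Icc (0 : ℝ) T := by
  have h : ∀ t, ∫ v, G.cost (v t) (G.pacingBid (G.state T ε μ₁ v t) (v t)) i ∂G.pathLaw
      ∈ Set.Icc (0 : ℝ) 1 := by
    intro t
    constructor
    · refine integral_nonneg_of_ae ?_
      filter_upwards [G.ae_pathLaw] with v hv using (G.cost_mem_Icc _ (hv t i)).1
    · calc _ ≤ ∫ _, (1 : ℝ) ∂G.pathLaw := by
            refine integral_mono_ae (integrable_cost T ε μ₁ i t) (integrable_const _) ?_
            filter_upwards [G.ae_pathLaw] with v hv using (G.cost_mem_Icc _ (hv t i)).2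
        _ = 1 := by simp
  rw [strategicCost_eq_sum]
  refine ⟨Finset.sum_nonneg fun t _ => (h t).1, ?_⟩
  simpa using Finset.sum_le_card_nsmul (Finset.range T) _ _ fun t _ => (h t).2

/-- Deviation of the average cost from the expected cost at `μ'`, given bounds on the expected
squared distances. -/
theorem abs_avg_strategicCost_sub_le {T : ℕ} (hT : 1 ≤ T) (ε : ℝ) {μ₁ μ' : Fin N → ℝ}
    (hμ₁ : μ₁ ∈ G.closedBox) (hμ' : μ' ∈ G.closedBox) (i : Fin N) {a : ℕ → ℝ} (ha : ∀ t, 0 < a t)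
    (hD : ∀ t, G.ampleSqDist T ε μ₁ μ' t ≤ a t ^ 2) :
    |1 / (T : ℝ) * G.strategicCost T ε μ₁ i - G.expectedCost i μ'|
      ≤ 1 / (T : ℝ) * (G.allocLip * ∑ t ∈ Finset.range T, a t + G.expectedNotAmple T ε μ₁) := by
  have hT' : (0 : ℝ) < T := Nat.cast_pos.2 hT
  have e : 1 / (T : ℝ) * G.strategicCost T ε μ₁ i - G.expectedCost i μ'
      = 1 / (T : ℝ) * ∑ t ∈ Finset.range T,
        (∫ v, G.cost (v t) (G.pacingBid (G.state T ε μ₁ v t) (v t)) i ∂G.pathLaw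
          - G.expectedCost i μ') := by
    rw [Finset.sum_sub_distrib, ← strategicCost_eq_sum, Finset.sum_const, Finset.card_range,
      nsmul_eq_mul]
    field_simp
  rw [e, abs_mul, abs_of_pos (by positivity : 0 < 1 / (T : ℝ))]
  refine mul_le_mul_of_nonneg_left ?_ (by positivity)
  refine (Finset.abs_sum_le_sum_abs _ _).trans ?_
  unfold expectedNotAmple
  rw [Finset.mul_sum, ← Finset.sum_add_distrib]
  exact Finset.sum_le_sum fun t _ =>
    abs_integral_cost_state_sub_le T ε hμ₁ hμ' i t (ha t) (hD t)

end PacingGame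

/-! ### Upper projections, small and large step sizes, and the constants. -/

namespace PacingGame

variable {N : ℕ} {G : PacingGame N}

theorem card_pos (G : PacingGame N) : 0 < N := G.γ_lt.pos

/-- If `ρ i * μhi ≥ Δ` for all agents, the upper projection is never active. -/
theorem tracksExpenditure_of_le {μ' : Fin N → ℝ} (h : ∀ i, G.Δ ≤ G.ρ i * G.μhi) {ε : ℝ}
    (hε : 0 < ε) (hε' : ε ≤ G.μlo * G.μhi / G.Δ) : G.TracksExpenditure μ' 0 ε := by
  intro s hs w hw i
  have hhi := G.μhi_pos
  have hp := G.pos_of_mem_closedBox hs.1 i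
  have hz := hs.payment_le_div hw i
  have hρ : G.Δ / G.μhi ≤ G.ρ i := (div_le_iff₀ hhi).2 (h i)
  have h1 : ε * (G.payment (G.pacingBid s w) i - G.ρ i) ≤ ε * (G.Δ / s.mult i - G.Δ / G.μhi) :=
    mul_le_mul_of_nonneg_left (by linarith) hε.le
  have h2 : ε * (G.Δ / s.mult i - G.Δ / G.μhi)
      = (ε * G.Δ / (s.mult i * G.μhi)) * (G.μhi - s.mult i) := by field_simp
  -- This is where the bound on ε enters: the increment is at most this factor times the gap μhi −
  -- μ_i, so it cannot overshoot μhi.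
  have h3 : ε * G.Δ / (s.mult i * G.μhi) ≤ 1 := by
    rw [div_le_one (by positivity)]
    rw [le_div_iff₀ G.Δ_pos] at hε'
    exact hε'.trans (mul_le_mul_of_nonneg_right (hs.1 i).1 hhi.le)
  have h4 := mul_le_mul_of_nonneg_right h3 (sub_nonneg.2 (hs.1 i).2)
  have e : (G.step ε s w).mult i
      = G.proj (s.mult i + ε * (G.payment (G.pacingBid s w) i - G.ρ i)) := rfl
  rw [e, zero_mul, mul_zero, sub_zero]
  exact le_min (le_max_left _ _) (by linarith)

/-- If `μ'` has distance at least `δ` to the upper bounds, projections at the upper bound occur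
only far from `μ'`. -/
theorem tracksExpenditure_of_add_le {μ' : Fin N → ℝ} {δ : ℝ} (hδ : 0 < δ)
    (h : ∀ i, μ' i + δ ≤ G.μhi) {ε : ℝ} (hε : 0 < ε) (hε' : ε ≤ δ / (2 * G.maxBid)) :
    G.TracksExpenditure μ' (G.maxBid * (4 / δ ^ 2)) ε := by
  intro s hs w hw i
  have hc := G.maxBid_pos
  have hz := hs.payment_le_maxBid hw i
  have hρ := G.ρ_pos i
  have hs' := (hs.1 i).2
  rw [le_div_iff₀ (by positivity)] at hε'
  have h1 : ε * (G.payment (G.pacingBid s w) i - G.ρ i) ≤ ε * G.maxBid :=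
    mul_le_mul_of_nonneg_left (by linarith) hε.le
  have h0 : 0 ≤ ε * (G.maxBid * (4 / δ ^ 2) * (s.mult i - μ' i) ^ 2) := by positivity
  have e : (G.step ε s w).mult i
      = G.proj (s.mult i + ε * (G.payment (G.pacingBid s w) i - G.ρ i)) := rfl
  rw [e]
  refine le_min ((sub_le_self _ h0).trans (le_max_left _ _)) ?_
  by_cases hfar : s.mult i + ε * (G.payment (G.pacingBid s w) i - G.ρ i) ≤ G.μhi
  · linarith
  -- The increment is at most ε·maxBid ≤ δ/2, so overshooting μhi forces a distance of at least δ/2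
  -- to μ'_i. There (4/δ²)(μ_i − μ'_i)² ≥ 1, and the charged term pays for the whole increment.
  · have h2 : δ / 2 ≤ s.mult i - μ' i := by linarith [h i]
    have h3 : 1 ≤ 4 / δ ^ 2 * (s.mult i - μ' i) ^ 2 := by
      rw [div_mul_eq_mul_div, one_le_div (by positivity)]
      linarith [pow_le_pow_left₀ (half_pos hδ).le h2 2, div_pow δ 2 2]
    have h4 := mul_le_mul_of_nonneg_left h3 (mul_pos hε hc).le
    linarith

/-- The bounds on the mean squared distance and on the average cost, with given constants. -/
def Bounds (G : PacingGame N) (μ' : Fin N → ℝ) (C₁ C₂ : ℝ) : Prop :=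
  ∀ (T : ℕ) (ε : ℝ) (μ₁ : Fin N → ℝ), 1 ≤ T → 0 < ε → μ₁ ∈ G.closedBox →
    G.avgSqDist T ε μ₁ μ' ≤ C₁ * N * (ε + (1 + ε) / (ε * T)) ∧
    ∀ i, |1 / (T : ℝ) * G.strategicCost T ε μ₁ i - G.dualObjective i μ'|
      ≤ C₂ * (1 / T + N * (ε ^ (1 / 2 : ℝ) + 1 / (ε * T)))

/-- No convergence is needed: the squared diameter of the box and the range [0, 1] of costs suffice,
enlarged by ε/ε₁ ≥ 1 and its root. -/
theorem bounds_of_large_step {μ' : Fin N → ℝ} (hst : G.IsStationary μ')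
    (hμ' : μ' ∈ G.closedBox) {ε₁ : ℝ} (hε₁ : 0 < ε₁) {T : ℕ} (hT : 1 ≤ T) {ε : ℝ}
    (hε : ε₁ ≤ ε) {μ₁ : Fin N → ℝ} (hμ₁ : μ₁ ∈ G.closedBox) :
    G.avgSqDist T ε μ₁ μ' ≤ (G.μhi - G.μlo) ^ 2 / ε₁ * N * ε ∧
    ∀ i, |1 / (T : ℝ) * G.strategicCost T ε μ₁ i - G.dualObjective i μ'| ≤ 1 / √ε₁ * √ε := by
  have hT' : (0 : ℝ) < T := Nat.cast_pos.2 hT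
  constructor
  · refine (avgSqDist_le_diam hT ε hμ₁ hμ').trans ?_
    have h1 : 1 ≤ ε / ε₁ := (one_le_div hε₁).2 hε
    calc (N : ℝ) * (G.μhi - G.μlo) ^ 2 ≤ N * (G.μhi - G.μlo) ^ 2 * (ε / ε₁) :=
          le_mul_of_one_le_right (by positivity) h1
      _ = _ := by ring
  · intro i
    rw [G.dualObjective_eq_expectedCost hμ' hst]
    have h1 := strategicCost_mem_Icc (G := G) T ε μ₁ i
    have h2 := G.expectedCost_mem_Icc i μ'
    have h3 : 1 / (T : ℝ) * G.strategicCost T ε μ₁ i ≤ 1 := by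
      rw [one_div, inv_mul_le_iff₀ hT', mul_one]; exact h1.2
    have h4 : 0 ≤ 1 / (T : ℝ) * G.strategicCost T ε μ₁ i := mul_nonneg (by positivity) h1.1
    have h5 : 1 ≤ 1 / √ε₁ * √ε := by
      rw [one_div_mul_eq_div, one_le_div (Real.sqrt_pos.2 hε₁)]
      exact Real.sqrt_le_sqrt hε
    refine le_trans (abs_le.2 ⟨?_, ?_⟩) h5 <;> linarith [h2.1, h2.2]

/-- The bounds for small step sizes; the constants do not depend on `N` otherwise than
through `κ`. -/
theorem bounds_of_small_step {lam r κ : ℝ} (hlam : 0 < lam) (hr : 0 < r) (hκ : 0 ≤ κ)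
    (hG : G.StronglyMonotone lam) {μ' : Fin N → ℝ} (hst : G.IsStationary μ')
    (hμ' : μ' ∈ G.openBox) (hrρ : ∀ i, r ≤ G.ρ i) {ε : ℝ} (hε : 0 < ε)
    (htr : G.TracksExpenditure μ' (κ / N) ε) (hε1 : ε ≤ 1) (hεlam : 2 * (ε * lam) ≤ 1)
    {A B : ℝ} (hA : A = (G.μhi - G.μlo) ^ 2 / (2 * lam) + G.maxBid ^ 2 / (2 * lam))
    (hB : B = (G.μhi - G.μlo + G.maxBid + κ * A) / r)
    {T : ℕ} (hT : 1 ≤ T) {μ₁ : Fin N → ℝ} (hμ₁ : μ₁ ∈ G.closedBox) :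
    G.avgSqDist T ε μ₁ μ' ≤ (A + (G.μhi - G.μlo) ^ 2 * B) * N * (ε + (1 + ε) / (ε * T)) ∧
    ∀ i, |1 / (T : ℝ) * G.strategicCost T ε μ₁ i - G.dualObjective i μ'|
      ≤ (G.allocLip * ((G.μhi - G.μlo) / lam + G.maxBid * √(1 / (2 * lam))) + B)
        * (1 / T + N * (√ε + 1 / (ε * T))) := by
  have hμc := G.openBox_subset_closedBox hμ'
  have hT' : (0 : ℝ) < T := Nat.cast_pos.2 hT
  have hN : (1 : ℝ) ≤ N := Nat.one_le_cast.2 G.card_pos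
  have hc := G.maxBid_pos
  have hw : 0 < G.μhi - G.μlo := sub_pos.2 G.μlo_lt_μhi
  have hL := G.allocLip_pos
  set w := G.μhi - G.μlo
  set c := G.maxBid
  set L := G.allocLip
  set Q : ℝ := 1 / ε + 1 + T * ε with hQ
  set S := ∑ t ∈ Finset.range T, G.ampleSqDist T ε μ₁ μ' t
  have hA0 : 0 < A := by rw [hA]; positivity
  have hB0 : 0 < B := by rw [hB]; positivity
  have hQX : 1 / (T : ℝ) * Q = ε + (1 + ε) / (ε * T) := by rw [hQ]; field_simp; ring
  have hS : S ≤ N * (A * Q) := by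
    refine (sum_ampleSqDist_le hlam hG hst hμ' hμ₁ T hε).trans ?_
    refine mul_le_mul_of_nonneg_left ?_ (by positivity)
    have h1 : 0 ≤ w ^ 2 / (2 * lam) * (1 + T * ε) := by positivity
    have h2 : 0 ≤ c ^ 2 / (2 * lam) * (1 / ε + 1) := by positivity
    rw [hA, hQ]
    linarith
  have hE : G.expectedNotAmple T ε μ₁ ≤ B * Q := by
    refine (htr.expectedNotAmple_le hε (by positivity) hr hrρ hμ₁ hμc T).trans ?_
    rw [hB, div_mul_eq_mul_div (w + c + κ * A) r Q]
    refine div_le_div_of_nonneg_right ?_ hr.le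
    -- The factor N in the bound on S cancels the N in κ/N, so B depends on N only through κ.
    have h1 : κ / N * S ≤ κ * A * Q := by
      refine (mul_le_mul_of_nonneg_left hS (by positivity)).trans (le_of_eq ?_)
      field_simp
    have h2 : 0 ≤ w * (1 + T * ε) := by positivity
    have h3 : 0 ≤ c * (1 / ε + T * ε) := by positivity
    have h4 : w / ε = w * (1 / ε) := by ring
    have h5 : (w + c) * Q = w * (1 / ε) + c + w * (1 + T * ε) + c * (1 / ε + T * ε) := by
      rw [hQ]; ring
    linarith
  constructor
  · refine (avgSqDist_le T ε hμ₁ hμc).trans ?_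
    rw [← hQX]
    have h1 : N * w ^ 2 * G.expectedNotAmple T ε μ₁ ≤ N * w ^ 2 * (B * Q) :=
      mul_le_mul_of_nonneg_left hE (by positivity)
    calc 1 / (T : ℝ) * (S + N * w ^ 2 * G.expectedNotAmple T ε μ₁)
        ≤ 1 / (T : ℝ) * (N * (A * Q) + N * w ^ 2 * (B * Q)) :=
          mul_le_mul_of_nonneg_left (add_le_add hS h1) (by positivity)
      _ = _ := by ring
  · intro i
    rw [G.dualObjective_eq_expectedCost hμc hst]
    set σ := √(1 / (2 * lam)) with hσ
    have hσ0 : 0 < σ := Real.sqrt_pos.2 (by positivity)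
    have hσ2 : σ ^ 2 = 1 / (2 * lam) := Real.sq_sqrt (by positivity)
    have hε0 : 0 < √ε := Real.sqrt_pos.2 hε
    have hε2 : √ε ^ 2 = ε := Real.sq_sqrt hε.le
    have hN2 : (N : ℝ) ≤ N ^ 2 := le_self_pow₀ hN two_ne_zero
    have ha0 : 0 < ε * lam := mul_pos hε hlam
    -- Here s solves 2ελs² = N²(ε·maxBid)². Using N in place of √N in both R and s is enough since N
    -- ≤ N², and matches the factor N of the cost bound.
    have hD := le_sq_of_contraction (D := G.ampleSqDist T ε μ₁ μ') (a := ε * lam)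
      (b := N * (ε * c) ^ 2) (R := N * w) (s := N * (c * (√ε * σ))) ha0.le hεlam (by positivity)
      (by positivity)
      ((ampleSqDist_zero_le T ε hμ₁ hμc).trans (by
        rw [mul_pow]; exact mul_le_mul_of_nonneg_right hN2 (sq_nonneg _)))
      (by
        have e : 2 * (ε * lam) * (N * (c * (√ε * σ))) ^ 2 = N ^ 2 * (ε * c) ^ 2 := by
          rw [mul_pow, mul_pow, mul_pow, hε2, hσ2]; field_simp
        rw [e]; exact mul_le_mul_of_nonneg_right hN2 (sq_nonneg _))
      (ampleSqDist_succ_le hG hst hμ' hμ₁ T hε.le)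
    refine (abs_avg_strategicCost_sub_le hT ε hμ₁ hμc i (fun t => ?_) hD).trans ?_
    · have h1 : 0 ≤ (1 - ε * lam) ^ t * (N * w) :=
        mul_nonneg (pow_nonneg (by linarith) t) (by positivity)
      have h2 : 0 < N * (c * (√ε * σ)) := by positivity
      linarith
    have hgeom := sum_geom_add_le (R := N * w) (s := N * (c * (√ε * σ))) ha0 (by linarith)
      (by positivity) T
    calc 1 / (T : ℝ) * (L * ∑ t ∈ Finset.range T,
            ((1 - ε * lam) ^ t * (N * w) + N * (c * (√ε * σ))) + G.expectedNotAmple T ε μ₁)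
        ≤ 1 / (T : ℝ) * (L * (N * w / (ε * lam) + T * (N * (c * (√ε * σ)))) + B * Q) := by
          gcongr
      _ = L * (N * (w / lam * (1 / (ε * T)) + c * σ * √ε))
          + B * (ε + 1 / T + 1 / (ε * T)) := by
          rw [hQ]; field_simp; ring
      _ ≤ L * ((w / lam + c * σ) * (1 / T + N * (√ε + 1 / (ε * T))))
          + B * (1 / T + N * (√ε + 1 / (ε * T))) := by
          have hX : 0 < 1 / (ε * T) := by positivity
          have hY : 0 < 1 / (T : ℝ) := by positivity
          have hεs : ε ≤ √ε := by nlinarith [Real.sqrt_le_one.2 hε1]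
          have hp : 0 < w / lam := by positivity
          have hq : 0 < c * σ := by positivity
          refine add_le_add (mul_le_mul_of_nonneg_left ?_ hL.le)
            (mul_le_mul_of_nonneg_left ?_ hB0.le)
          · have h1 : 0 ≤ w / lam * (1 / T + N * √ε) := by positivity
            have h2 : 0 ≤ c * σ * (1 / T + N * (1 / (ε * T))) := by positivity
            linarith
          · linarith [le_mul_of_one_le_left (add_pos hε0 hX).le hN]
      _ = _ := by ring

/-- The constants are built from the listed parameters before N and the game are introduced, which
is what makes them uniform over games. -/
theorem exists_bounds {Δ lo hi nuHi lam r κ ε₀ : ℝ} (hΔ : 0 < Δ) (hlo : 0 < lo) (hlohi : lo < hi)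
    (hnu : 0 < nuHi) (hlam : 0 < lam) (hr : 0 < r) (hκ : 0 ≤ κ) (hε₀ : 0 < ε₀) :
    ∃ C₁ C₂ : ℝ, 0 ≤ C₁ ∧ 0 ≤ C₂ ∧ ∀ (N : ℕ) (G : PacingGame N), G.Δ = Δ → G.μlo = lo →
      G.μhi = hi → G.νhi = nuHi → G.StronglyMonotone lam →
      ∀ μ' : Fin N → ℝ, G.IsStationary μ' → μ' ∈ G.openBox → (∀ i, r ≤ G.ρ i) →
      (∀ ε, 0 < ε → ε ≤ ε₀ → G.TracksExpenditure μ' (κ / N) ε) → G.Bounds μ' C₁ C₂ := by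
  -- Below this threshold tracking holds, ε ≤ √ε, and the contraction factor 1 − 2ελ is nonnegative;
  -- above it the trivial bounds apply.
  set ε₁ := min ε₀ (min 1 (1 / (2 * lam))) with hε₁
  have hε₁0 : 0 < ε₁ := lt_min hε₀ (lt_min one_pos (by positivity))
  set c := Δ / lo with hc
  set L := 4 * nuHi * hi / lo ^ 2 with hL
  set A := (hi - lo) ^ 2 / (2 * lam) + c ^ 2 / (2 * lam) with hA
  set B := (hi - lo + c + κ * A) / r with hB
  have hw : 0 < hi - lo := sub_pos.2 hlohi
  have hhi : 0 < hi := hlo.trans hlohi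
  have hc0 : 0 < c := by positivity
  have hA0 : 0 < A := by positivity
  have hB0 : 0 < B := by positivity
  have hL0 : 0 < L := by positivity
  set P₁ := A + (hi - lo) ^ 2 * B with hP₁
  set P₂ := L * ((hi - lo) / lam + c * √(1 / (2 * lam))) + B with hP₂
  have hP₁0 : 0 < P₁ := by positivity
  have hP₂0 : 0 < P₂ := by positivity
  refine ⟨P₁ + (hi - lo) ^ 2 / ε₁, P₂ + 1 / √ε₁, by positivity, by positivity, ?_⟩
  intro N G e1 e2 e3 e4 hG μ' hst hμ' hrρ htr T ε μ₁ hT hε hμ₁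
  have hT' : (0 : ℝ) < T := Nat.cast_pos.2 hT
  have hN : (1 : ℝ) ≤ N := Nat.one_le_cast.2 G.card_pos
  have hX : 0 < 1 / (ε * T) := by positivity
  have hY : 0 < 1 / (T : ℝ) := by positivity
  have hZ : 0 < (1 + ε) / (ε * T) := by positivity
  have hs : 0 < √ε := Real.sqrt_pos.2 hε
  have hs₁ : 0 < √ε₁ := Real.sqrt_pos.2 hε₁0
  rw [← Real.sqrt_eq_rpow]
  rcases le_total ε ε₁ with hle | hle
  · obtain ⟨h1, h2⟩ := bounds_of_small_step (A := A) (B := B) hlam hr hκ hG hst hμ' hrρ hε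
      (htr ε hε (hle.trans (min_le_left _ _)))
      (hle.trans ((min_le_right _ _).trans (min_le_left _ _)))
      (by
        have := hle.trans ((min_le_right _ _).trans (min_le_right _ _))
        rw [le_div_iff₀ (by positivity)] at this
        linarith)
      (by rw [hA, hc, maxBid, e1, e2, e3]) (by rw [hB, hc, maxBid, e1, e2, e3]) hT hμ₁
    rw [e2, e3] at h1
    refine ⟨h1.trans ?_, fun i => (h2 i).trans ?_⟩
    · have : 0 ≤ (hi - lo) ^ 2 / ε₁ := by positivity
      gcongr ?_ * N * _
      exact le_add_of_nonneg_right this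
    · rw [allocLip, maxBid, e1, e2, e3, e4]
      have : 0 ≤ 1 / √ε₁ := by positivity
      refine mul_le_mul_of_nonneg_right ?_ (by positivity)
      exact le_add_of_nonneg_right this
  · obtain ⟨h1, h2⟩ := bounds_of_large_step hst (G.openBox_subset_closedBox hμ') hε₁0 hT hle hμ₁
    rw [e2, e3] at h1
    refine ⟨h1.trans ?_, fun i => (h2 i).trans ?_⟩
    · gcongr
      · linarith
      · linarith
    · gcongr
      · linarith
      · linarith [le_mul_of_one_le_left (add_pos hs hX).le hN]

theorem Bounds.tendsto {μ' : Fin N → ℝ} {C₁ C₂ : ℝ} (h : G.Bounds μ' C₁ C₂) {ε : ℕ → ℝ}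
    {μ₁ : ℕ → Fin N → ℝ} (hε : ∀ T, 0 < ε T) (hμ₁ : ∀ T, μ₁ T ∈ G.closedBox)
    (hε0 : Filter.Tendsto ε Filter.atTop (nhds 0))
    (hTε : Filter.Tendsto (fun T : ℕ => (T : ℝ) * ε T) Filter.atTop Filter.atTop) :
    Filter.Tendsto (fun T : ℕ => G.avgSqDist T (ε T) (μ₁ T) μ') Filter.atTop (nhds 0) ∧
      ∀ i, Filter.Tendsto (fun T : ℕ => 1 / (T : ℝ) * G.strategicCost T (ε T) (μ₁ T) i
        - G.dualObjective i μ') Filter.atTop (nhds 0) := by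
  have hinv : Filter.Tendsto (fun T : ℕ => 1 / (ε T * T)) Filter.atTop (nhds 0) := by
    have := hTε.inv_tendsto_atTop
    refine this.congr fun T => ?_
    rw [Pi.inv_apply, one_div, mul_comm]
  have hge : ∀ᶠ T : ℕ in Filter.atTop, 1 ≤ T := Filter.eventually_ge_atTop 1
  constructor
  · refine squeeze_zero' (Filter.Eventually.of_forall fun T => avgSqDist_nonneg _ _ _ _)
      (hge.mono fun T hT => (h T (ε T) (μ₁ T) hT (hε T) (hμ₁ T)).1) ?_
    have h1 := (hε0.add ((hε0.const_add 1).mul hinv)).const_mul (C₁ * N)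
    simpa [div_eq_mul_inv] using h1
  · intro i
    refine squeeze_zero_norm' (hge.mono fun T hT => (h T (ε T) (μ₁ T) hT (hε T) (hμ₁ T)).2 i) ?_
    have h1 : Filter.Tendsto (fun T => ε T ^ (1 / 2 : ℝ)) Filter.atTop (nhds 0) := by
      have := hε0.rpow_const (p := 1 / 2) (Or.inr (by norm_num))
      rwa [Real.zero_rpow (by norm_num)] at this
    have h2 : Filter.Tendsto (fun T : ℕ => 1 / (T : ℝ)) Filter.atTop (nhds 0) :=
      tendsto_one_div_atTop_nhds_zero_nat
    simpa using (h2.add ((h1.add hinv).const_mul (N : ℝ))).const_mul C₂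

theorem exists_pos_le (G : PacingGame N) {f : Fin N → ℝ} (hf : ∀ i, 0 < f i) :
    ∃ r, 0 < r ∧ ∀ i, r ≤ f i := by
  have : Nonempty (Fin N) := ⟨⟨0, G.card_pos⟩⟩
  obtain ⟨i, hi⟩ := Finite.exists_min f
  exact ⟨f i, hf i, hi⟩

end PacingGame

theorem theoremB2 (Δ lo hi nuHi lam : ℝ) (hlam : 0 < lam) :
    ∃ K₁ K₂ : ℝ, 0 ≤ K₁ ∧ 0 ≤ K₂ ∧
      ∀ (N : ℕ) (G : PacingGame N), G.Δ = Δ → G.μlo = lo → G.μhi = hi → G.νhi = nuHi →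
      G.StronglyMonotone lam →
      ∀ μstar : Fin N → ℝ, G.IsStationary μstar → μstar ∈ G.openBox →
      ∃ C₁ C₂ : ℝ, 0 ≤ C₁ ∧ 0 ≤ C₂ ∧
        ((∀ i, G.Δ ≤ G.ρ i * G.μhi) → C₁ = K₁ ∧ C₂ = K₂) ∧
        (∀ (T : ℕ) (ε : ℝ) (μ₁ : Fin N → ℝ), 1 ≤ T → 0 < ε → μ₁ ∈ G.closedBox →
          G.avgSqDist T ε μ₁ μstar ≤ C₁ * N * (ε + (1 + ε) / (ε * T)) ∧
          ∀ i, |1 / (T : ℝ) * G.strategicCost T ε μ₁ i - G.dualObjective i μstar|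
            ≤ C₂ * (1 / T + N * (ε ^ (1 / 2 : ℝ) + 1 / (ε * T)))) ∧
        (∀ (ε : ℕ → ℝ) (μ₁ : ℕ → Fin N → ℝ), (∀ T, 0 < ε T) → (∀ T, μ₁ T ∈ G.closedBox) →
          Filter.Tendsto ε Filter.atTop (nhds 0) →
          Filter.Tendsto (fun T : ℕ => (T : ℝ) * ε T) Filter.atTop Filter.atTop →
          Filter.Tendsto (fun T : ℕ => G.avgSqDist T (ε T) (μ₁ T) μstar)
            Filter.atTop (nhds 0) ∧
          ∀ i, Filter.Tendsto
            (fun T : ℕ => 1 / (T : ℝ) * G.strategicCost T (ε T) (μ₁ T) i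
              - G.dualObjective i μstar)
            Filter.atTop (nhds 0)) := by
  by_cases hpos : 0 < Δ ∧ 0 < lo ∧ lo < hi ∧ 0 < nuHi
  · obtain ⟨hΔ, hlo, hlohi, hnu⟩ := hpos
    have hhi : 0 < hi := hlo.trans hlohi
    -- If Δ ≤ ρ_i μhi, then Δ/hi is a lower bound on all target rates, and κ = 0 because no upper
    -- projection occurs for ε ≤ lo·hi/Δ.
    obtain ⟨K₁, K₂, hK₁, hK₂, hK⟩ := PacingGame.exists_bounds hΔ hlo hlohi hnu hlam
      (r := Δ / hi) (κ := 0) (ε₀ := lo * hi / Δ) (by positivity) le_rfl (by positivity)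
    refine ⟨K₁, K₂, hK₁, hK₂, ?_⟩
    intro N G e1 e2 e3 e4 hG μstar hst hμ
    suffices H : ∃ C₁ C₂ : ℝ, 0 ≤ C₁ ∧ 0 ≤ C₂ ∧
        ((∀ i, G.Δ ≤ G.ρ i * G.μhi) → C₁ = K₁ ∧ C₂ = K₂) ∧ G.Bounds μstar C₁ C₂ by
      obtain ⟨C₁, C₂, h1, h2, h3, h4⟩ := H
      exact ⟨C₁, C₂, h1, h2, h3, h4, fun ε μ₁ hε hμ₁ hε0 hTε => h4.tendsto hε hμ₁ hε0 hTε⟩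
    by_cases hc : ∀ i, G.Δ ≤ G.ρ i * G.μhi
    · refine ⟨K₁, K₂, hK₁, hK₂, fun _ => ⟨rfl, rfl⟩, hK N G e1 e2 e3 e4 hG μstar hst hμ ?_ ?_⟩
      · intro i
        rw [div_le_iff₀ hhi, ← e1, ← e3]
        exact hc i
      · intro ε hε hε'
        rw [zero_div]
        exact PacingGame.tracksExpenditure_of_le hc hε (by rwa [e1, e2, e3])
    -- Without that condition the constants may depend on the game: on the smallest target rate r,
    -- on the smallest gap δ between μ⋆ and the upper bound, and on N, the factor of κ that offsets
    -- the division in κ/N.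
    · obtain ⟨r, hr, hrρ⟩ := G.exists_pos_le G.ρ_pos
      obtain ⟨δ, hδ, hδμ⟩ := G.exists_pos_le fun i => sub_pos.2 (hμ i).2
      have hm := G.maxBid_pos
      obtain ⟨C₁, C₂, hC₁, hC₂, hC⟩ := PacingGame.exists_bounds hΔ hlo hlohi hnu hlam
        (r := r) (κ := N * (G.maxBid * (4 / δ ^ 2))) (ε₀ := δ / (2 * G.maxBid)) hr
        (by positivity) (by positivity)
      refine ⟨C₁, C₂, hC₁, hC₂, fun h => absurd h hc,
        hC N G e1 e2 e3 e4 hG μstar hst hμ hrρ fun ε hε hε' => ?_⟩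
      rw [mul_div_cancel_left₀ _ (Nat.cast_ne_zero.2 G.card_pos.ne')]
      exact PacingGame.tracksExpenditure_of_add_le hδ (fun i => by linarith [hδμ i]) hε hε'
  -- No game has such parameters, so any constants serve.
  · refine ⟨0, 0, le_rfl, le_rfl, ?_⟩
    rintro N G rfl rfl rfl rfl
    exact absurd ⟨G.Δ_pos, G.μlo_pos, G.μlo_lt_μhi, G.νhi_pos⟩ hpos
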